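/- Let $p$ be a prime and $S$ a finite $p$-group. A fusion system $\mathcal F$ on $S$ is a category whose objects are the subgroups of $S$ and whose morphism sets satisfy $\operatorname{Hom}_S(P,Q)\subseteq \operatorname{Hom}_{\mathcal F}(P,Q)\subseteq\operatorname{Inj}(P,Q)$, where $\operatorname{Hom}_S(P,Q)$ is the set of maps $P\to Q$, $x\mapsto g^{-1}xg$, with $g\in S$ and $g^{-1}Pg\le Q$, and $\operatorname{Inj}(P,Q)$ is the set of injective group homomorphisms, such that every morphism factorizes as an $\mathcal F$-isomorphism onto its image followed by an inclusion. Write $\operatorname{Aut}_{\mathcal F}(P)=\operatorname{Hom}_{\mathcal F}(P,P)$ and $\operatorname{Out}_{\mathcal F}(P)=\operatorname{Aut}_{\mathcal F}(P)/\operatorname{Inn}(P)$, let $\operatorname{Aut}_S(P)$ be the group of automorphisms of $P$ induced by $N_S(P)$, and call the images of $P$ under morphisms in $\operatorname{Hom}_{\mathcal F}(P,S)$ the $\mathcal F$-conjugates of $P$. For an isomorphism $\alpha\colon P\to Q$ in $\mathcal F$, let $N_\alpha$ be the group of all $g\in N_S(P)$ for which the automorphism $y\mapsto\alpha(g^{-1}\alpha^{-1}(y)g)$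 of $Q$ lies in $\operatorname{Aut}_S(Q)$. The fusion system $\mathcal F$ is saturated if every $P\le S$ has an $\mathcal F$-conjugate $Q$ such that $\operatorname{Aut}_S(Q)\in\operatorname{Syl}_p(\operatorname{Aut}_{\mathcal F}(Q))$ and every $\mathcal F$-isomorphism $\alpha\colon R\to Q$ with $R\le S$ extends to a morphism $N_\alpha\to S$ in $\mathcal F$. A subgroup $P\le S$ is $\mathcal F$-essential if $P<S$, $C_S(Q)=Z(Q)$ and $|N_S(P)|\ge|N_S(Q)|$ for every $\mathcal F$-conjugate $Q$ of $P$, and $G=\operatorname{Out}_{\mathcal F}(P)$ has a strongly $p$-embedded subgroup, that is, a subgroup $H<G$ with $p\mid|H|$ and $p\nmid|H\cap gHg^{-1}|$ for all $g\in G\setminus H$. An $\mathcal F$-pearl is an $\mathcal F$-essential subgroup which is either of order $p^2$ or non-abelian of order $p^3$. Lemma (pearlprune). Let $\mathcal F$ be a saturated fusion system on the finite $p$-group $S$, and let $\mathcal C$ be a set of representatives of the $\mathcal F$-conjugacy classes of $\mathcal F$-essential subgroups (so $\mathcal C$ consists of $\mathcal F$-essential subgroups, and every $\mathcal F$-essential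 subgroup is $\mathcal F$-conjugate to exactly one member of $\mathcal C$). If $P\in\mathcal C$ is an $\mathcal F$-pearl, then the fusion system $$\mathcal G=\langle \operatorname{Aut}_{\mathcal F}(S),\ \operatorname{Aut}_{\mathcal F}(E)\mid E\in\mathcal C\setminus\{P\}\rangle,$$ that is, the smallest fusion system on $S$ containing all these automorphisms as morphisms, is saturated. -/

import Mathlib

/-- A fusion system on a group `S`: a category whose objects are the subgroups of `S` and whose
morphisms are injective group homomorphisms, containing all maps `x ↦ g⁻¹ x g` with `g ∈ S`
(in particular identities and inclusions), and such that every morphism factorizes as an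
isomorphism of the category onto a subgroup followed by an inclusion. -/
@[ext]
structure FusionSystem (S : Type*) [Group S] where
  Hom : (P Q : Subgroup S) → Set (P →* Q)
  injective' : ∀ {P Q : Subgroup S} (φ : P →* Q), φ ∈ Hom P Q → Function.Injective φ
  conj_mem' : ∀ {P Q : Subgroup S} (g : S) (φ : P →* Q),
    (∀ x : P, (φ x : S) = g⁻¹ * (x : S) * g) → φ ∈ Hom P Q
  comp_mem' : ∀ {P Q R : Subgroup S} (φ : P →* Q) (ψ : Q →* R),
    φ ∈ Hom P Q → ψ ∈ Hom Q R → ψ.comp φ ∈ Hom P R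
  factor' : ∀ {P Q : Subgroup S} (φ : P →* Q), φ ∈ Hom P Q →
    ∃ (R : Subgroup S) (hR : R ≤ Q) (e : P ≃* R),
      e.toMonoidHom ∈ Hom P R ∧ e.symm.toMonoidHom ∈ Hom R P ∧
        φ = (Subgroup.inclusion hR).comp e.toMonoidHom

/-- A subgroup `H` of a finite group `G` is strongly `p`-embedded if it is proper, has order
divisible by `p`, and `H ∩ gHg⁻¹` has order prime to `p` for all `g ∈ G \ H`. -/
def IsStronglyEmbedded (p : ℕ) {G : Type*} [Group G] (H : Subgroup G) : Prop :=
  H ≠ ⊤ ∧ p ∣ Nat.card H ∧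
    ∀ g : G, g ∉ H →
      ¬ p ∣ Nat.card (H ⊓ H.map (MulAut.conj g).toMonoidHom : Subgroup G)

/-- The group `Inn(G)` of inner automorphisms. -/
def innAut (G : Type*) [Group G] : Subgroup (MulAut G) :=
  (MulAut.conj : G →* MulAut G).range

instance innAut_normal (G : Type*) [Group G] : (innAut G).Normal := by
  refine ⟨?_⟩
  rintro _ ⟨x, rfl⟩ a
  refine ⟨a x, ?_⟩
  ext y
  simp [MulAut.conj_apply, MulAut.mul_apply]

namespace FusionSystem

variable {S : Type*} [Group S]

/-- `Aut_S(P)`: the automorphisms of `P` induced by conjugation by elements of `N_S(P)`. -/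
def autS (P : Subgroup S) : Subgroup (MulAut P) :=
  (Subgroup.normalizerMonoidHom P).range

/-- `P` is `S`-centric: `C_S(P) = Z(P)`. -/
def IsSCentric (P : Subgroup S) : Prop :=
  Subgroup.centralizer (P : Set S) = (Subgroup.center P).map P.subtype

/-- For an isomorphism `α : P → Q`, the subgroup `N_α` of those `g ∈ N_S(P)` such that the
automorphism of `Q` obtained by transporting conjugation by `g` along `α` lies in `Aut_S(Q)`. -/
def extControl {P Q : Subgroup S} (α : P ≃* Q) : Subgroup S :=
  (((autS Q).comap (MulAut.congr α).toMonoidHom).comap (Subgroup.normalizerMonoidHom P)).map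
    (Subgroup.normalizer (P : Set S)).subtype

theorem le_extControl {P Q : Subgroup S} (α : P ≃* Q) : P ≤ extControl α := by
  intro g hg
  refine ⟨⟨g, Subgroup.le_normalizer hg⟩, ?_, rfl⟩
  refine ⟨⟨α ⟨g, hg⟩, Subgroup.le_normalizer (α ⟨g, hg⟩).2⟩, ?_⟩
  ext y
  have h : Subgroup.normalizerMonoidHom P ⟨g, Subgroup.le_normalizer hg⟩ (α.symm y) =
      (⟨g, hg⟩ : P) * α.symm y * (⟨g, hg⟩ : P)⁻¹ := by
    ext
    simp
  have h' : (MulAut.congr α) (Subgroup.normalizerMonoidHom P ⟨g, Subgroup.le_normalizer hg⟩) y =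
      α (Subgroup.normalizerMonoidHom P ⟨g, Subgroup.le_normalizer hg⟩ (α.symm y)) := rfl
  change _ = (((MulAut.congr α)
    (Subgroup.normalizerMonoidHom P ⟨g, Subgroup.le_normalizer hg⟩) y : Q) : S)
  rw [h', h]
  simp

variable (F : FusionSystem S)

/-- `Aut_F(P) = Hom_F(P, P)`, as a group of automorphisms of `P`. -/
def autF (P : Subgroup S) : Subgroup (MulAut P) where
  carrier := {a | MulEquiv.toMonoidHom a ∈ F.Hom P P}
  mul_mem' {a b} ha hb := F.comp_mem' _ _ hb ha
  one_mem' := F.conj_mem' 1 _ (by intro x; simp)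
  inv_mem' {a} ha := by
    obtain ⟨R, hR, e, -, he, h⟩ := F.factor' _ ha
    have hval : ∀ x : P, ((a x : P) : S) = (e x : S) := fun x =>
      congrArg Subtype.val (DFunLike.congr_fun h x)
    have hRP : R = P := by
      refine le_antisymm hR fun x hx => ?_
      have := hval (a.symm ⟨x, hx⟩)
      rw [MulEquiv.apply_symm_apply] at this
      change x = _ at this
      rw [this]
      exact (e _).2
    subst hRP
    have hae : a = e := MulEquiv.ext fun x => Subtype.ext (hval x)
    subst hae
    exact he

/-- `P` and `Q` are `F`-conjugate, that is, `Q` is the image of `P` under a morphism of `F`. -/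
def IsConj (P Q : Subgroup S) : Prop :=
  ∃ φ ∈ F.Hom P ⊤, Q = φ.range.map (⊤ : Subgroup S).subtype

def IsFullyNormalized (P : Subgroup S) : Prop :=
  ∀ Q, F.IsConj P Q →
    Nat.card (Subgroup.normalizer (Q : Set S)) ≤ Nat.card (Subgroup.normalizer (P : Set S))

/-- `Aut_S(P)` is a Sylow `p`-subgroup of `Aut_F(P)`. -/
def IsFullyAutomized (p : ℕ) (P : Subgroup S) : Prop :=
  ∃ T : Sylow p (F.autF P), (T : Subgroup (F.autF P)) = (autS P).subgroupOf (F.autF P)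

/-- Every isomorphism `α : P → Q` in `F` extends to a morphism `N_α → S` in `F`. -/
def IsReceptive (Q : Subgroup S) : Prop :=
  ∀ (P : Subgroup S) (α : P ≃* Q), α.toMonoidHom ∈ F.Hom P Q →
    ∃ β ∈ F.Hom (extControl α) ⊤,
      ∀ x : P, ((β (Subgroup.inclusion (le_extControl α) x) : (⊤ : Subgroup S)) : S) = (α x : S)

/-- `F` is saturated (with respect to the prime `p`): every subgroup of `S` is `F`-conjugate to a
fully automized and receptive subgroup. -/
def IsSaturated (p : ℕ) : Prop :=
  ∀ P : Subgroup S, ∃ Q, F.IsConj P Q ∧ F.IsFullyAutomized p Q ∧ F.IsReceptive Q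

def IsCentric (P : Subgroup S) : Prop :=
  ∀ Q, F.IsConj P Q → IsSCentric Q

/-- `Out_F(P) = Aut_F(P) / Inn(P)`. -/
abbrev outF (P : Subgroup S) : Type _ :=
  F.autF P ⧸ (innAut P).subgroupOf (F.autF P)

def IsEssential (p : ℕ) (P : Subgroup S) : Prop :=
  P < ⊤ ∧ F.IsCentric P ∧ F.IsFullyNormalized P ∧
    ∃ H : Subgroup (F.outF P), IsStronglyEmbedded p H

/-- An essential subgroup that has order `p²` or is non-abelian of order `p³`. -/
def IsPearl (p : ℕ) (P : Subgroup S) : Prop :=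
  F.IsEssential p P ∧
    (Nat.card P = p ^ 2 ∨ (Nat.card P = p ^ 3 ∧ ¬ ∀ x y : P, x * y = y * x))

/-- `C` consists of essential subgroups, exactly one from each `F`-conjugacy class
containing an essential subgroup. -/
def IsEssentialReps (p : ℕ) (C : Set (Subgroup S)) : Prop :=
  (∀ E ∈ C, F.IsEssential p E) ∧ ∀ E, F.IsEssential p E → ∃! R, R ∈ C ∧ F.IsConj E R

/-- All members of a set `X` of homomorphisms between subgroups of `S` are morphisms of `F`. -/
def Contains (X : Set (Σ P : Subgroup S, Σ Q : Subgroup S, P →* Q)) : Prop :=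
  ∀ x ∈ X, x.2.2 ∈ F.Hom x.1 x.2.1

/-- The fusion system `⟨X⟩` generated by a set `X` of monomorphisms between subgroups of `S`: the
intersection of all fusion systems on `S` containing `X`. -/
def generate (X : Set (Σ P : Subgroup S, Σ Q : Subgroup S, P →* Q)) : FusionSystem S where
  Hom P Q := {φ | Function.Injective φ ∧ ∀ G : FusionSystem S, G.Contains X → φ ∈ G.Hom P Q}
  injective' _ h := h.1
  conj_mem' {P Q} g φ h := by
    refine ⟨fun x y hxy => ?_, fun G _ => G.conj_mem' g φ h⟩
    have := h x
    rw [hxy, h y] at this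
    exact Subtype.ext (by simpa using this.symm)
  comp_mem' φ ψ hφ hψ :=
    ⟨hψ.1.comp hφ.1, fun G hG => G.comp_mem' φ ψ (hφ.2 G hG) (hψ.2 G hG)⟩
  factor' {P Q} φ hφ := by
    let R : Subgroup S := (Q.subtype.comp φ).range
    have hR : R ≤ Q := by
      rintro _ ⟨x, rfl⟩
      exact (φ x).2
    let e : P ≃* R := MonoidHom.ofInjective (f := Q.subtype.comp φ)
      (Q.subtype_injective.comp hφ.1)
    have key : ∀ G : FusionSystem S, G.Contains X →
        e.toMonoidHom ∈ G.Hom P R ∧ e.symm.toMonoidHom ∈ G.Hom R P := by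
      intro G hG
      obtain ⟨R', hR', e', h1, h2, h3⟩ := G.factor' φ (hφ.2 G hG)
      have hval : ∀ x : P, (e' x : S) = (e x : S) := fun x =>
        (congrArg Subtype.val (DFunLike.congr_fun h3 x)).symm
      have hRR : R' = R := by
        ext y
        constructor
        · intro hy
          have := hval (e'.symm ⟨y, hy⟩)
          rw [MulEquiv.apply_symm_apply] at this
          change y = _ at this
          rw [this]
          exact (e _).2
        · intro hy
          have := hval (e.symm ⟨y, hy⟩)
          rw [MulEquiv.apply_symm_apply] at this
          change _ = y at this
          rw [← this]
          exact (e' _).2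
      subst hRR
      have hee : e' = e := MulEquiv.ext fun x => Subtype.ext (hval x)
      rw [← hee]
      exact ⟨h1, h2⟩
    exact ⟨R, hR, e, ⟨e.injective, fun G hG => (key G hG).1⟩,
      ⟨e.symm.injective, fun G hG => (key G hG).2⟩, rfl⟩

/-- The set of all elements of the groups `Aut_F(E)` with `E ∈ D`. -/
def automizers (D : Set (Subgroup S)) : Set (Σ P : Subgroup S, Σ Q : Subgroup S, P →* Q) :=
  {x | ∃ E ∈ D, ∃ a ∈ F.autF E, x = ⟨E, E, MulEquiv.toMonoidHom a⟩}

end FusionSystem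

/-! Let D consist of S and the members of C other than P, so that the subsystem G is generated by
the F-automorphisms of the members of D. Alperin's argument, run relative to P
(`generate_mor_of_not_subConj`), shows that F and G have the same morphisms on every subgroup that
is not F-conjugate into P. Only F-conjugates of subgroups of P can cause trouble, and there the
small order of a pearl is decisive.

The criterion `exists_isReceptive_generate` treats a class K of subgroups closed under F-conjugation
by splitting off a set Y. For a member of Y, any member of D that contains it contains its
normalizer too; so every G-morphism on it, being a composite of restrictions of automorphisms of
members of D, extends to the normalizer. Outside Y, a G-morphism defined on the normalizer moves the
subgroup to one whose normalizer is not conjugate into P. The extensions provided by saturation of F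
are then either trivial or live on subgroups where F and G agree, so a good F-conjugate is also good
for G.

Conjugates A of P need no Y, because A < N_S(A). If |P| = p², only orders 1 and p remain; here
|Z(S)| = p, and Y consists of the noncentral R of order p with RZ(S) conjugate to P. If P is
non-abelian of order p³, then for order p² the set Y consists of the W whose normalizer is conjugate
to P (`clsNormalizer`), and for order p of the noncentral R with RZ(S) such a W.

Strong embedding enters in the last case. It forces Aut_F(P) to move each subgroup of order p² of P
to an Aut_S(P)-invariant one (`exists_smul_invariant`), which is normalized by N_S(P). So each has a
conjugate with normalizer of order at least p⁴ (`exists_mor_card_normalizer_ge`). Hence no W in Y is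
fully normalized, W is not in D, and comparing orders of normalizers shows that Y is stable
(`clsNormalizer_invariant`). -/

namespace FusionSystem

/-! ### Morphisms as restrictions of functions on S -/

variable {S : Type*} [Group S]

/-- The subgroup generated by the image of a subgroup under a map; it is the image itself as soon
as the map is multiplicative on the subgroup. -/
def img (f : S → S) (A : Subgroup S) : Subgroup S := Subgroup.closure (f '' A)

/-- The restriction of `f : S → S` to `A` is a morphism of `F`. -/
def Mor (F : FusionSystem S) (f : S → S) (A : Subgroup S) : Prop :=
  ∃ φ ∈ F.Hom A ⊤, ∀ x : A, ((φ x : (⊤ : Subgroup S)) : S) = f x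

theorem img_mono (f : S → S) {A B : Subgroup S} (h : A ≤ B) : img f A ≤ img f B :=
  Subgroup.closure_mono (Set.image_mono h)

theorem img_congr {f g : S → S} {A : Subgroup S} (h : ∀ x ∈ A, f x = g x) :
    img f A = img g A := by
  unfold img
  congr 1
  exact Set.image_congr h

theorem apply_mem_img (f : S → S) {A : Subgroup S} {x : S} (hx : x ∈ A) : f x ∈ img f A :=
  Subgroup.subset_closure ⟨x, hx, rfl⟩

theorem img_le_iff (f : S → S) {A B : Subgroup S} : img f A ≤ B ↔ ∀ x ∈ A, f x ∈ B := by
  unfold img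
  rw [Subgroup.closure_le]
  constructor
  · intro h x hx
    exact h ⟨x, hx, rfl⟩
  · rintro h _ ⟨x, hx, rfl⟩
    exact h x hx

theorem exists_fun {A B : Subgroup S} (φ : A → B) : ∃ f : S → S, ∀ x : A, (φ x : S) = f x := by
  classical
  refine ⟨fun s => if h : s ∈ A then φ ⟨s, h⟩ else 1, fun x => ?_⟩
  simp

variable {F : FusionSystem S}

theorem mor_of_mem_hom {f : S → S} {A B : Subgroup S} {φ : A →* B} (hφ : φ ∈ F.Hom A B)
    (h : ∀ x : A, (φ x : S) = f x) : F.Mor f A := by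
  refine ⟨(Subgroup.inclusion le_top).comp φ, F.comp_mem' _ _ hφ ?_, fun x => by simpa using h x⟩
  exact F.conj_mem' 1 _ (by intro x; simp)

/-- The codomain is immaterial: by the factorization axiom a morphism into S is an isomorphism onto
its image, which can then be included in any subgroup containing that image. -/
theorem Mor.mem_hom {f : S → S} {A B : Subgroup S} (hf : F.Mor f A) {φ : A →* B}
    (h : ∀ x : A, (φ x : S) = f x) : φ ∈ F.Hom A B := by
  obtain ⟨ψ, hψ, hψf⟩ := hf
  obtain ⟨R, hR, e, he, -, hfac⟩ := F.factor' ψ hψ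
  have hval : ∀ x : A, (e x : S) = f x := fun x => by
    rw [← hψf x, hfac]; simp
  have hRB : R ≤ B := by
    intro y hy
    have := hval (e.symm ⟨y, hy⟩)
    rw [MulEquiv.apply_symm_apply, ← h] at this
    change y = _ at this
    rw [this]
    exact (φ _).2
  have : φ = (Subgroup.inclusion hRB).comp e.toMonoidHom := by
    ext x
    simp [h x, hval x]
  rw [this]
  exact F.comp_mem' _ _ he (F.conj_mem' 1 _ (by intro x; simp))

namespace Mor

variable {f g : S → S} {A B : Subgroup S}

theorem map_mul (hf : F.Mor f A) {x y : S} (hx : x ∈ A) (hy : y ∈ A) : f (x * y) = f x * f y := by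
  obtain ⟨φ, -, h⟩ := hf
  have := congrArg Subtype.val (_root_.map_mul φ ⟨x, hx⟩ ⟨y, hy⟩)
  simpa [h] using this

theorem map_one (hf : F.Mor f A) : f 1 = 1 := by
  have := hf.map_mul A.one_mem A.one_mem
  simpa using this

theorem map_inv (hf : F.Mor f A) {x : S} (hx : x ∈ A) : f x⁻¹ = (f x)⁻¹ := by
  have := hf.map_mul hx (A.inv_mem hx)
  rw [mul_inv_cancel, hf.map_one] at this
  exact (inv_eq_of_mul_eq_one_right this.symm).symm

theorem map_conj (hf : F.Mor f A) {x y : S} (hx : x ∈ A) (hy : y ∈ A) :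
    f (x * y * x⁻¹) = f x * f y * (f x)⁻¹ := by
  rw [hf.map_mul (A.mul_mem hx hy) (A.inv_mem hx), hf.map_mul hx hy, hf.map_inv hx]

theorem injOn (hf : F.Mor f A) {x y : S} (hx : x ∈ A) (hy : y ∈ A) (h : f x = f y) : x = y := by
  obtain ⟨φ, hφ, hφf⟩ := hf
  have : φ ⟨x, hx⟩ = φ ⟨y, hy⟩ := Subtype.ext (by rw [hφf, hφf]; exact h)
  exact congrArg Subtype.val (F.injective' φ hφ this)

theorem mem_img (hf : F.Mor f A) {y : S} : y ∈ img f A ↔ ∃ x ∈ A, f x = y := by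
  constructor
  · intro hy
    refine Subgroup.closure_induction (p := fun y _ => ∃ x ∈ A, f x = y) ?_ ?_ ?_ ?_ hy
    · rintro _ ⟨x, hx, rfl⟩
      exact ⟨x, hx, rfl⟩
    · exact ⟨1, A.one_mem, hf.map_one⟩
    · rintro _ _ _ _ ⟨x, hx, rfl⟩ ⟨y, hy, rfl⟩
      exact ⟨x * y, A.mul_mem hx hy, hf.map_mul hx hy⟩
    · rintro _ _ ⟨x, hx, rfl⟩
      exact ⟨x⁻¹, A.inv_mem hx, hf.map_inv hx⟩
  · rintro ⟨x, hx, rfl⟩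
    exact apply_mem_img f hx

theorem coe_img (hf : F.Mor f A) : (img f A : Set S) = f '' A :=
  Set.ext fun _ => hf.mem_img

theorem congr (hf : F.Mor f A) (h : ∀ x ∈ A, f x = g x) : F.Mor g A := by
  obtain ⟨φ, hφ, hφf⟩ := hf
  exact ⟨φ, hφ, fun x => (hφf x).trans (h x x.2)⟩

theorem restrict (hf : F.Mor f A) (h : B ≤ A) : F.Mor f B := by
  obtain ⟨φ, hφ, hφf⟩ := hf
  exact ⟨φ.comp (Subgroup.inclusion h),
    F.comp_mem' _ _ (F.conj_mem' 1 _ (by intro x; simp)) hφ, fun x => by simp [hφf]⟩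

theorem mem_img_iff (hf : F.Mor f A) (h : B ≤ A) {x : S} (hx : x ∈ A) :
    f x ∈ img f B ↔ x ∈ B := by
  rw [(hf.restrict h).mem_img]
  constructor
  · rintro ⟨y, hy, hxy⟩
    rwa [← hf.injOn (h hy) hx hxy]
  · intro hx
    exact ⟨x, hx, rfl⟩

theorem card_img (hf : F.Mor f A) : Nat.card (img f A) = Nat.card A := by
  have h : Set.InjOn f A := fun x hx y hy h => hf.injOn hx hy h
  have := Nat.card_image_of_injOn h
  rw [← hf.coe_img] at this
  exact this

theorem equiv (hf : F.Mor f A) (h : img f A = B) :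
    ∃ e : A ≃* B, e.toMonoidHom ∈ F.Hom A B ∧ ∀ x : A, (e x : S) = f x := by
  let φ : A →* B :=
    { toFun := fun x => ⟨f x, h ▸ apply_mem_img f x.2⟩
      map_one' := Subtype.ext hf.map_one
      map_mul' := fun x y => Subtype.ext (hf.map_mul x.2 y.2) }
  have hφ : Function.Bijective φ := by
    constructor
    · intro x y hxy
      exact Subtype.ext (hf.injOn x.2 y.2 (congrArg Subtype.val hxy))
    · rintro ⟨y, hy⟩
      rw [← h, hf.mem_img] at hy
      obtain ⟨x, hx, rfl⟩ := hy
      exact ⟨⟨x, hx⟩, rfl⟩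
  refine ⟨MulEquiv.ofBijective φ hφ, hf.mem_hom fun x => rfl, fun x => rfl⟩

theorem comp (hg : F.Mor g B) (hf : F.Mor f A) (h : img f A ≤ B) : F.Mor (g ∘ f) A := by
  obtain ⟨e, he, hef⟩ := hf.equiv rfl
  obtain ⟨ψ, hψ, hψg⟩ := hg.restrict h
  exact ⟨ψ.comp e.toMonoidHom, F.comp_mem' _ _ he hψ, fun x => by simp [hψg, hef]⟩

theorem img_comp (hf : F.Mor f A) (g : S → S) : img (g ∘ f) A = img g (img f A) := by
  rw [img, img, Set.image_comp, ← hf.coe_img]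

theorem inv (hf : F.Mor f A) :
    ∃ g, F.Mor g (img f A) ∧ (∀ x ∈ A, g (f x) = x) ∧ img g (img f A) = A := by
  obtain ⟨e, he, hef⟩ := hf.equiv rfl
  obtain ⟨R, hR, e', -, he', hfac⟩ := F.factor' _ he
  have hval : ∀ x : A, (e' x : S) = e x := fun x =>
    (congrArg Subtype.val (DFunLike.congr_fun hfac x)).symm
  have hRA : R = img f A := by
    refine le_antisymm hR fun y hy => ?_
    have := hval (e.symm ⟨y, hy⟩)
    rw [MulEquiv.apply_symm_apply] at this
    change _ = y at this
    rw [← this]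
    exact (e' _).2
  subst hRA
  have hee : e' = e := MulEquiv.ext fun x => Subtype.ext (hval x)
  subst hee
  obtain ⟨g, hg⟩ := exists_fun e'.symm
  have hgf : ∀ x ∈ A, g (f x) = x := by
    intro x hx
    have := hg (e' ⟨x, hx⟩)
    rw [MulEquiv.symm_apply_apply, hef] at this
    exact this.symm
  refine ⟨g, mor_of_mem_hom he' hg, hgf, ?_⟩
  rw [← hf.img_comp, img_congr (f := g ∘ f) (g := id) (fun x hx => hgf x hx)]
  simp [img]

theorem normalizer_mem (hf : F.Mor f A) (hB : B ≤ A) {x : S} (hx : x ∈ A)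
    (hxn : x ∈ Subgroup.normalizer (B : Set S)) :
    f x ∈ Subgroup.normalizer (img f B : Set S) := by
  have hfB := hf.restrict hB
  rw [Subgroup.mem_normalizer_iff] at hxn
  have key : ∀ x ∈ A, (∀ h, h ∈ B ↔ x * h * x⁻¹ ∈ B) → ∀ y, y ∈ img f B →
      f x * y * (f x)⁻¹ ∈ img f B := by
    intro x hx hxn y hy
    obtain ⟨b, hb, rfl⟩ := hfB.mem_img.1 hy
    rw [← hf.map_conj hx (hB hb)]
    exact apply_mem_img f ((hxn b).1 hb)
  rw [Subgroup.mem_normalizer_iff]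
  intro y
  refine ⟨key x hx hxn y, fun hy => ?_⟩
  have := key x⁻¹ (A.inv_mem hx) (fun h => by rw [hxn (x⁻¹ * h * x⁻¹⁻¹)]; simp [mul_assoc]) _ hy
  rw [hf.map_inv hx] at this
  simpa [mul_assoc] using this

theorem img_normalizer_le (hf : F.Mor f (Subgroup.normalizer (A : Set S))) :
    img f (Subgroup.normalizer (A : Set S)) ≤ Subgroup.normalizer (img f A : Set S) :=
  (img_le_iff f).2 fun _ hx => hf.normalizer_mem Subgroup.le_normalizer hx hx

theorem centralizer_mem (hf : F.Mor f A) (hB : B ≤ A) {x : S} (hx : x ∈ A)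
    (hxc : x ∈ Subgroup.centralizer (B : Set S)) :
    f x ∈ Subgroup.centralizer (img f B : Set S) := by
  rw [Subgroup.mem_centralizer_iff] at hxc ⊢
  intro y hy
  obtain ⟨b, hb, rfl⟩ := (hf.restrict hB).mem_img.1 hy
  rw [← hf.map_mul hx (hB hb), ← hf.map_mul (hB hb) hx, hxc b hb]

end Mor

theorem mor_conj (F : FusionSystem S) (s : S) (A : Subgroup S) : F.Mor (fun x => s * x * s⁻¹) A :=
  mor_of_mem_hom (B := ⊤)
    (φ := ((MulAut.conj s).toMonoidHom.comp A.subtype).codRestrict ⊤ fun _ => trivial)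
    (F.conj_mem' s⁻¹ _ (by intro x; simp)) (by intro x; simp)

theorem mor_id (F : FusionSystem S) (A : Subgroup S) : F.Mor id A :=
  (F.mor_conj 1 A).congr (by simp)

theorem img_id (A : Subgroup S) : img id A = A := by simp [img]

theorem isConj_iff {P Q : Subgroup S} : F.IsConj P Q ↔ ∃ f, F.Mor f P ∧ img f P = Q := by
  constructor
  · rintro ⟨φ, hφ, rfl⟩
    obtain ⟨f, hf⟩ := exists_fun φ
    have hm := mor_of_mem_hom hφ hf
    refine ⟨f, hm, ?_⟩
    ext y
    rw [hm.mem_img]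
    simp only [Subgroup.mem_map, MonoidHom.mem_range]
    constructor
    · rintro ⟨x, hx, rfl⟩
      exact ⟨φ ⟨x, hx⟩, ⟨⟨x, hx⟩, rfl⟩, hf ⟨x, hx⟩⟩
    · rintro ⟨_, ⟨x, rfl⟩, rfl⟩
      exact ⟨x, x.2, (hf x).symm⟩
  · rintro ⟨f, hf, rfl⟩
    obtain ⟨φ, hφ, hφf⟩ := id hf
    refine ⟨φ, hφ, ?_⟩
    ext y
    rw [hf.mem_img]
    simp only [Subgroup.mem_map, MonoidHom.mem_range]
    constructor
    · rintro ⟨x, hx, rfl⟩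
      exact ⟨φ ⟨x, hx⟩, ⟨⟨x, hx⟩, rfl⟩, hφf ⟨x, hx⟩⟩
    · rintro ⟨_, ⟨x, rfl⟩, rfl⟩
      exact ⟨x, x.2, (hφf x).symm⟩

theorem mem_autF_iff {A : Subgroup S} {a : MulAut A} {f : S → S} (h : ∀ x : A, (a x : S) = f x) :
    a ∈ F.autF A ↔ F.Mor f A :=
  ⟨fun ha => mor_of_mem_hom (φ := MulEquiv.toMonoidHom a) ha h, fun hf => hf.mem_hom h⟩

theorem img_eq_of_mulEquiv {A B : Subgroup S} (e : A ≃* B) {f : S → S}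
    (h : ∀ x : A, (e x : S) = f x) : img f A = B := by
  refine le_antisymm ((img_le_iff f).2 fun x hx => h ⟨x, hx⟩ ▸ (e _).2) fun y hy => ?_
  have := h (e.symm ⟨y, hy⟩)
  rw [MulEquiv.apply_symm_apply] at this
  change y = _ at this
  rw [this]
  exact apply_mem_img f (e.symm _).2

end FusionSystem

/-! ### Extension control, receptivity and full automization -/

theorem Sylow.exists_conj_mem {p : ℕ} [Fact p.Prime] {G : Type*} [Group G] [Finite G]
    (T : Sylow p G) {U : Subgroup G} (hU : IsPGroup p U) :
    ∃ g : G, ∀ u ∈ U, g * u * g⁻¹ ∈ (T : Subgroup G) := by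
  obtain ⟨T', hT'⟩ := hU.exists_le_sylow
  obtain ⟨g, hg⟩ := MulAction.exists_smul_eq G T' T
  refine ⟨g, fun u hu => ?_⟩
  rw [← hg]
  have := Subgroup.smul_mem_pointwise_smul u (MulAut.conj g) (T' : Subgroup G) (hT' hu)
  simpa [Sylow.coe_subgroup_smul] using this

namespace FusionSystem

variable {S : Type*} [Group S] {F : FusionSystem S}

/-- The element `g` normalizes `A`, and the automorphism that it induces on `A` is transported by
`f` to one induced by an element of `S`. -/
def Ctrl (f : S → S) (A : Subgroup S) (g : S) : Prop :=
  g ∈ Subgroup.normalizer (A : Set S) ∧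
    ∃ h ∈ Subgroup.normalizer (img f A : Set S), ∀ x ∈ A, f (g * x * g⁻¹) = h * f x * h⁻¹

theorem mem_autS_iff {A : Subgroup S} {a : MulAut A} :
    a ∈ autS A ↔ ∃ h ∈ Subgroup.normalizer (A : Set S), ∀ x : A, (a x : S) = h * x * h⁻¹ := by
  unfold autS
  rw [MonoidHom.mem_range]
  constructor
  · rintro ⟨h, rfl⟩
    exact ⟨h, h.2, fun x => by simp⟩
  · rintro ⟨h, hh, hx⟩
    refine ⟨⟨h, hh⟩, ?_⟩
    ext x
    simp [hx]

theorem autS_le_autF (A : Subgroup S) : autS A ≤ F.autF A := by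
  intro a ha
  obtain ⟨h, -, hx⟩ := mem_autS_iff.1 ha
  exact (mem_autF_iff (f := fun x => h * x * h⁻¹) hx).2 (F.mor_conj h A)

theorem mem_extControl_iff {A B : Subgroup S} (α : A ≃* B) {f : S → S}
    (h : ∀ x : A, (α x : S) = f x) (g : S) : g ∈ extControl α ↔ Ctrl f A g := by
  have hB : img f A = B := img_eq_of_mulEquiv α h
  subst hB
  unfold extControl Ctrl
  simp only [Subgroup.mem_map, Subgroup.mem_comap]
  constructor
  · rintro ⟨g, hg, rfl⟩
    refine ⟨g.2, ?_⟩
    obtain ⟨k, hk, hkx⟩ := mem_autS_iff.1 hg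
    refine ⟨k, hk, fun x hx => ?_⟩
    have := hkx (α ⟨x, hx⟩)
    rw [h] at this
    rw [← this]
    change _ = (α ((Subgroup.normalizerMonoidHom A g) (α.symm (α ⟨x, hx⟩))) : S)
    rw [MulEquiv.symm_apply_apply, h]
    simp
  · rintro ⟨hg, k, hk, hkx⟩
    refine ⟨⟨g, hg⟩, mem_autS_iff.2 ⟨k, hk, fun y => ?_⟩, rfl⟩
    obtain ⟨x, rfl⟩ := α.surjective y
    change (α ((Subgroup.normalizerMonoidHom A ⟨g, hg⟩) (α.symm (α x))) : S) = _
    rw [MulEquiv.symm_apply_apply, h, h, ← hkx x x.2]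
    simp

/-- N_α is specified here only by its elements, so that it makes sense for a function on S without
choosing an isomorphism. -/
theorem isReceptive_iff {Q : Subgroup S} : F.IsReceptive Q ↔
    ∀ (A : Subgroup S) (f : S → S), F.Mor f A → img f A = Q →
      ∃ N : Subgroup S, (∀ g, g ∈ N ↔ Ctrl f A g) ∧ ∃ k, F.Mor k N ∧ ∀ x ∈ A, k x = f x := by
  constructor
  · intro hQ A f hf hfA
    obtain ⟨e, he, hef⟩ := hf.equiv hfA
    obtain ⟨β, hβ, hβx⟩ := hQ A e he
    obtain ⟨k, hk⟩ := exists_fun β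
    refine ⟨extControl e, mem_extControl_iff e hef, k, mor_of_mem_hom hβ hk, fun x hx => ?_⟩
    rw [← hef ⟨x, hx⟩, ← hβx ⟨x, hx⟩, hk]
    rfl
  · intro hQ A e he
    obtain ⟨f, hef⟩ := exists_fun e
    obtain ⟨N, hN, k, hk, hkx⟩ := hQ A f (mor_of_mem_hom he hef) (img_eq_of_mulEquiv e hef)
    have hNe : N = extControl e := by
      ext g
      rw [hN, mem_extControl_iff e hef]
    subst hNe
    obtain ⟨β, hβ, hβx⟩ := hk
    refine ⟨β, hβ, fun x => ?_⟩
    rw [hβx, hef]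
    exact hkx x x.2

theorem Mor.ctrl_of_mem {f : S → S} {A : Subgroup S} (hf : F.Mor f A) {g : S} (hg : g ∈ A) :
    Ctrl f A g :=
  ⟨Subgroup.le_normalizer hg, f g, Subgroup.le_normalizer (apply_mem_img f hg),
    fun _ hx => hf.map_conj hg hx⟩

theorem ctrl_of_mem_centralizer {f : S → S} {A : Subgroup S} {g : S}
    (hg : g ∈ Subgroup.centralizer (A : Set S)) : Ctrl f A g := by
  have hc : ∀ x ∈ A, g * x * g⁻¹ = x := fun x hx => by
    rw [← Subgroup.mem_centralizer_iff.1 hg x hx, mul_inv_cancel_right]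
  refine ⟨Subgroup.centralizer_le_normalizer _ hg, 1, one_mem _, fun x hx => by simp [hc x hx]⟩

theorem isPGroup_autS {p : ℕ} (hS : IsPGroup p S) (A : Subgroup S) : IsPGroup p (autS A) :=
  (hS.to_subgroup (Subgroup.normalizer (A : Set S))).of_surjective
    (Subgroup.normalizerMonoidHom A).rangeRestrict (MonoidHom.rangeRestrict_surjective _)

/-- Transporting Aut_S(Q) along f gives a p-subgroup of Aut_F(R). After f is composed with an
automorphism of R that conjugates it into the Sylow subgroup Aut_S(R), the extension domain is all
of N_S(Q). -/
theorem exists_mor_normalizer [Finite S] {p : ℕ} [Fact p.Prime] (hS : IsPGroup p S)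
    {Q R : Subgroup S} (ha : F.IsFullyAutomized p R) (hr : F.IsReceptive R)
    {f : S → S} (hf : F.Mor f Q) (hfQ : img f Q = R) :
    ∃ k, F.Mor k (Subgroup.normalizer (Q : Set S)) ∧ img k Q = R := by
  obtain ⟨e, he, hef⟩ := hf.equiv hfQ
  obtain ⟨T, hT⟩ := ha
  let U : Subgroup (MulAut R) := (autS Q).map (MulAut.congr e).toMonoidHom
  have hUp : IsPGroup p U := (isPGroup_autS hS Q).map _
  have hUF : U ≤ F.autF R := by
    rintro _ ⟨a, ha, rfl⟩
    obtain ⟨g, hg⟩ := exists_fun a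
    have haM := (mem_autF_iff hg).1 (autS_le_autF (F := F) Q ha)
    obtain ⟨i, hi, hix, hiQ⟩ := hf.inv
    have hi' : F.Mor (f ∘ (g ∘ i)) (img f Q) := by
      refine hf.comp (haM.comp hi hiQ.le) ?_
      rw [hi.img_comp, hiQ, img_eq_of_mulEquiv a hg]
    rw [hfQ] at hi'
    refine (mem_autF_iff fun y => ?_).2 hi'
    obtain ⟨x, rfl⟩ := e.surjective y
    change (e (a (e.symm (e x))) : S) = f (g (i (e x)))
    rw [MulEquiv.symm_apply_apply, hef, hef, hg, hix x x.2]
  have hUp' : IsPGroup p (U.subgroupOf (F.autF R)) :=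
    hUp.comap_of_injective (F.autF R).subtype (Subgroup.subtype_injective _)
  obtain ⟨c, hc⟩ := T.exists_conj_mem hUp'
  obtain ⟨d, hd⟩ := exists_fun (c : MulAut R)
  have hdM := (mem_autF_iff hd).1 c.2
  have hdR : img d R = R := img_eq_of_mulEquiv (c : MulAut R) hd
  have hdf : F.Mor (d ∘ f) Q := hdM.comp hf hfQ.le
  have hdfQ : img (d ∘ f) Q = R := by rw [hf.img_comp, hfQ, hdR]
  obtain ⟨N, hN, k, hk, hkx⟩ := isReceptive_iff.1 hr Q _ hdf hdfQ
  -- The conjugation by c is exactly what puts the transported action of each g in N_S(Q) inside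
  -- Aut_S(R).
  have hNn : Subgroup.normalizer (Q : Set S) ≤ N := by
    intro g hg
    rw [hN]
    refine ⟨hg, ?_⟩
    let a : MulAut Q := Subgroup.normalizerMonoidHom Q ⟨g, hg⟩
    have haU : MulAut.congr e a ∈ U := ⟨a, ⟨_, rfl⟩, rfl⟩
    have h1 := hc ⟨_, hUF haU⟩ haU
    rw [hT] at h1
    obtain ⟨h, hh, hhx⟩ := mem_autS_iff.1 h1
    refine ⟨h, hdfQ.symm ▸ hh, fun x hx => ?_⟩
    have h2 := hhx (c.1 (e ⟨x, hx⟩))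
    have h3 : (((c * ⟨_, hUF haU⟩ * c⁻¹ : F.autF R) : MulAut R) (c.1 (e ⟨x, hx⟩)) : R) =
        c.1 (e (a ⟨x, hx⟩)) := by
      change c.1 (e (a (e.symm (c.1⁻¹ (c.1 (e ⟨x, hx⟩)))))) = _
      rw [MulAut.inv_apply_self, MulEquiv.symm_apply_apply]
    change ((((c * ⟨_, hUF haU⟩ * c⁻¹ : F.autF R) : MulAut R) (c.1 (e ⟨x, hx⟩)) : R) : S) = _ at h2
    rw [h3, hd, hef, hd, hef] at h2
    simpa [a] using h2
  refine ⟨k, hk.restrict hNn, ?_⟩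
  rw [img_congr hkx, hdfQ]

theorem isFullyAutomized_of_card_le {p : ℕ} [Fact p.Prime] [Finite S] (hS : IsPGroup p S)
    {R : Subgroup S}
    (h : ∀ U : Subgroup (MulAut R), IsPGroup p U → Nat.card U ≤ Nat.card (autS R)) :
    F.IsFullyAutomized p R := by
  have h2 : IsPGroup p ((autS R).subgroupOf (F.autF R)) :=
    (isPGroup_autS hS R).comap_of_injective (F.autF R).subtype (Subgroup.subtype_injective _)
  obtain ⟨T, hT⟩ := h2.exists_le_sylow
  refine ⟨T, (Subgroup.eq_of_le_of_card_ge hT ?_).symm⟩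
  have h3 := h _ (T.isPGroup'.map (F.autF R).subtype)
  rw [Nat.card_congr (Subgroup.equivMapOfInjective (T : Subgroup (F.autF R)) _
    (Subgroup.subtype_injective _)).toEquiv.symm] at h3
  refine h3.trans ?_
  rw [Nat.card_congr (Subgroup.subgroupOfEquivOfLe (autS_le_autF R)).toEquiv]

/-- Full automization passes to a smaller fusion system. -/
theorem IsFullyAutomized.mono {p : ℕ} [Fact p.Prime] [Finite S] {G : FusionSystem S}
    {R : Subgroup S} (h : F.IsFullyAutomized p R) (hGF : G.autF R ≤ F.autF R) :
    G.IsFullyAutomized p R := by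
  obtain ⟨T, hT⟩ := h
  have hp : IsPGroup p (autS R) := by
    have := T.isPGroup'
    rw [hT] at this
    have := this.map (F.autF R).subtype
    rwa [Subgroup.map_subgroupOf_eq_of_le (autS_le_autF R)] at this
  have h2 : IsPGroup p ((autS R).subgroupOf (G.autF R)) :=
    hp.comap_of_injective (G.autF R).subtype (Subgroup.subtype_injective _)
  obtain ⟨T', hT'⟩ := h2.exists_le_sylow
  refine ⟨T', le_antisymm (fun a ha => ?_) hT'⟩
  -- The image of T' is a p-subgroup containing the Sylow subgroup Aut_S(R) of Aut_F(R), so the two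
  -- coincide.
  have h3 : (T' : Subgroup (G.autF R)).map (Subgroup.inclusion hGF) = T := by
    refine T.is_maximal' (T'.isPGroup'.map _) ?_
    rw [hT]
    intro b hb
    exact ⟨⟨b.1, autS_le_autF R hb⟩, hT' hb, rfl⟩
  have h4 : Subgroup.inclusion hGF a ∈ (T : Subgroup (F.autF R)) := h3 ▸ ⟨a, ha, rfl⟩
  rw [hT] at h4
  exact h4

end FusionSystem

/-! ### Generated subsystems as composites of restrictions -/

namespace FusionSystem

variable {S : Type*} [Group S] {F : FusionSystem S} {D : Set (Subgroup S)}

theorem contains_automizers : F.Contains (F.automizers D) := by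
  rintro _ ⟨E, -, a, ha, rfl⟩
  exact ha

theorem Mor.of_generate {f : S → S} {A : Subgroup S}
    (h : (generate (F.automizers D)).Mor f A) : F.Mor f A := by
  obtain ⟨φ, hφ, hφf⟩ := h
  exact ⟨φ, hφ.2 F contains_automizers, hφf⟩

theorem autF_generate_le (A : Subgroup S) : (generate (F.automizers D)).autF A ≤ F.autF A := by
  intro a ha
  obtain ⟨f, hf⟩ := exists_fun a
  exact (mem_autF_iff hf).2 ((mem_autF_iff hf).1 ha).of_generate

theorem generate_mor {E : Subgroup S} (hE : E ∈ D) {a : S → S} (ha : F.Mor a E)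
    (haE : img a E = E) : (generate (F.automizers D)).Mor a E := by
  obtain ⟨e, he, hea⟩ := ha.equiv haE
  refine mor_of_mem_hom (φ := e.toMonoidHom) ⟨e.injective, fun G hG => ?_⟩ hea
  exact hG ⟨E, E, e.toMonoidHom⟩ ⟨E, hE, e, he, rfl⟩

variable (F D) in
/-- `f` agrees on `A` with a composite of restrictions of `F`-automorphisms of members of `D`. -/
inductive Reach (A : Set S) : (S → S) → Prop
  | refl : Reach A id
  | step {f a : S → S} {E : Subgroup S} : Reach A f → E ∈ D → F.Mor a E →
      img a E = E → (∀ x ∈ A, f x ∈ E) → Reach A (a ∘ f)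

namespace Reach

theorem mono {A B : Set S} {f : S → S} (h : Reach F D A f) (hB : B ⊆ A) : Reach F D B f := by
  induction h with
  | refl => exact refl
  | step _ hE ha haE hfE ih => exact step ih hE ha haE fun x hx => hfE x (hB hx)

theorem comp {A : Set S} {f g : S → S} (hf : Reach F D A f) {B : Set S} (hg : Reach F D B g)
    (hB : ∀ x ∈ A, f x ∈ B) : Reach F D A (g ∘ f) := by
  induction hg with
  | refl => exact hf
  | step _ hE ha haE hgE ih =>
    rw [Function.comp_assoc]
    exact step ih hE ha haE fun x hx => hgE _ (hB x hx)

theorem inv {A : Set S} {f : S → S} (hf : Reach F D A f) :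
    ∃ g, Reach F D (f '' A) g ∧ ∀ x ∈ A, g (f x) = x := by
  induction hf with
  | refl => exact ⟨id, refl, fun x _ => rfl⟩
  | @step f a E _ hE ha haE hfE ih =>
    obtain ⟨g, hg, hgx⟩ := ih
    obtain ⟨b, hb, hbx, hbE⟩ := ha.inv
    rw [haE] at hb hbE
    have h1 : Reach F D ((a ∘ f) '' A) (b ∘ id) := by
      refine step refl hE hb hbE ?_
      rintro _ ⟨x, hx, rfl⟩
      rw [← haE]
      exact apply_mem_img a (hfE x hx)
    refine ⟨g ∘ b, comp h1 hg ?_, fun x hx => ?_⟩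
    · rintro _ ⟨x, hx, rfl⟩
      exact ⟨x, hx, (hbx _ (hfE x hx)).symm⟩
    · simp only [Function.comp_apply]
      rw [hbx _ (hfE x hx), hgx x hx]

theorem mor {A : Subgroup S} {f : S → S} (hf : Reach F D A f) :
    (generate (F.automizers D)).Mor f A := by
  induction hf with
  | refl => exact mor_id _ A
  | step _ hE ha haE hfE ih =>
    exact (generate_mor hE ha haE).comp ih ((img_le_iff _).2 hfE)

end Reach

variable (F D) in
/-- The fusion system of all composites of restrictions of `F`-automorphisms of members of `D`. -/
def reachSystem (hD : ⊤ ∈ D) : FusionSystem S where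
  Hom A B := {φ | Function.Injective φ ∧ ∃ f, Reach F D A f ∧ ∀ x : A, (φ x : S) = f x}
  injective' _ h := h.1
  conj_mem' {A B} g φ h := by
    refine ⟨fun x y hxy => ?_, (fun x => g⁻¹ * x * g⁻¹⁻¹) ∘ id, ?_, fun x => by simp [h]⟩
    · have := h x
      rw [hxy, h y] at this
      exact Subtype.ext (by simpa using this.symm)
    -- Conjugation by an element of S is the restriction of an automorphism of S itself; this is why
    -- S must belong to D.
    · refine Reach.refl.step hD (F.mor_conj g⁻¹ ⊤) ?_ (fun _ _ => trivial)
      refine eq_top_iff.2 fun y _ => ((F.mor_conj g⁻¹ ⊤).mem_img).2 ⟨g * y * g⁻¹, trivial, ?_⟩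
      group
  comp_mem' {A B R} φ ψ hφ hψ := by
    obtain ⟨hφ, f, hf, hφf⟩ := hφ
    obtain ⟨hψ, g, hg, hψg⟩ := hψ
    refine ⟨hψ.comp hφ, g ∘ f, hf.comp hg fun x hx => ?_, fun x => ?_⟩
    · rw [← hφf ⟨x, hx⟩]
      exact (φ ⟨x, hx⟩).2
    · simp [hψg, hφf]
  factor' {A B} φ hφ := by
    obtain ⟨hφ, f, hf, hφf⟩ := hφ
    let R : Subgroup S := (B.subtype.comp φ).range
    have hR : R ≤ B := by
      rintro _ ⟨x, rfl⟩
      exact (φ x).2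
    let e : A ≃* R := MonoidHom.ofInjective (f := B.subtype.comp φ)
      (B.subtype_injective.comp hφ)
    have he : ∀ x : A, (e x : S) = f x := hφf
    obtain ⟨g, hg, hgx⟩ := hf.inv
    refine ⟨R, hR, e, ⟨e.injective, f, hf, hφf⟩, ⟨e.symm.injective, g, hg.mono ?_, ?_⟩, rfl⟩
    · rintro _ ⟨x, rfl⟩
      exact ⟨x, x.2, (hφf x).symm⟩
    · intro y
      obtain ⟨x, rfl⟩ := e.surjective y
      change ((e.symm (e x) : A) : S) = g (e x)
      rw [MulEquiv.symm_apply_apply, he, hgx x x.2]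

/-- The composites of restrictions already form a fusion system containing the generators, so by
minimality the generated system has no other morphisms. -/
theorem Mor.reach (hD : ⊤ ∈ D) {f : S → S} {A : Subgroup S}
    (h : (generate (F.automizers D)).Mor f A) :
    ∃ g, Reach F D A g ∧ ∀ x ∈ A, f x = g x := by
  obtain ⟨φ, hφ, hφf⟩ := h
  have hcon : (reachSystem F D hD).Contains (F.automizers D) := by
    rintro _ ⟨E, hE, a, ha, rfl⟩
    obtain ⟨f, hf⟩ := exists_fun a
    refine ⟨a.injective, f ∘ id, Reach.refl.step hE ((mem_autF_iff hf).1 ha)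
      (img_eq_of_mulEquiv a hf) (fun x hx => hx), hf⟩
  obtain ⟨-, g, hg, hφg⟩ := hφ.2 _ hcon
  exact ⟨g, hg, fun x hx => by rw [← hφg ⟨x, hx⟩, ← hφf ⟨x, hx⟩]⟩

end FusionSystem

/-! ### Strong embedding modulo a normal p-subgroup, and growth of normalizers -/

theorem isPGroup_zpowers_of_pow_eq_one {p : ℕ} {G : Type*} [Group G] {a : G} {k : ℕ} (ha : a ^ p ^ k = 1) :
    IsPGroup p (Subgroup.zpowers a) := by
  rintro ⟨_, n, rfl⟩
  refine ⟨k, Subtype.ext ?_⟩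
  change (a ^ n) ^ (p ^ k) = 1
  rw [← zpow_natCast, zpow_comm, zpow_natCast, ha, one_zpow]

theorem isPGroup_zpowers_of_quotient {p : ℕ} [Fact p.Prime] {G : Type*} [Group G] [Finite G]
    {I : Subgroup G} [I.Normal] (hI : IsPGroup p I) {x : G}
    (hx : (QuotientGroup.mk' I x) ^ p = 1) : IsPGroup p (Subgroup.zpowers x) := by
  rw [← map_pow, ← MonoidHom.mem_ker, QuotientGroup.ker_mk'] at hx
  obtain ⟨k, hk⟩ := hI ⟨_, hx⟩
  have hk' : x ^ (p ^ (k + 1)) = 1 := by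
    rw [pow_succ', pow_mul]
    exact congrArg Subtype.val hk
  exact isPGroup_zpowers_of_pow_eq_one hk'

/-- A proper subgroup containing a Sylow subgroup and controlling its fusion modulo a normal
`p`-subgroup is strongly embedded modulo that subgroup. -/
theorem isStronglyEmbedded_map_mk {p : ℕ} [Fact p.Prime] {G : Type*} [Group G] [Finite G]
    (I : Subgroup G) [I.Normal] (hI : IsPGroup p I) (B : Sylow p G) (hIB : I < B)
    (H : Subgroup G) (hBH : B ≤ H) (hH : H ≠ ⊤)
    (key : ∀ a u : G, u ∈ B → u ∉ I → a * u * a⁻¹ ∈ B → a ∈ H) :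
    IsStronglyEmbedded p (H.map (QuotientGroup.mk' I)) := by
  have hmem : ∀ x : G, QuotientGroup.mk' I x ∈ H.map (QuotientGroup.mk' I) ↔ x ∈ H := by
    intro x
    rw [← Subgroup.mem_comap, Subgroup.comap_map_eq, QuotientGroup.ker_mk',
      sup_eq_left.2 (hIB.le.trans hBH)]
  have hconj : ∀ x ∈ H, IsPGroup p (Subgroup.zpowers x) → ∃ h ∈ H, h * x * h⁻¹ ∈ B := by
    intro x hx hxp
    obtain ⟨g, hg⟩ := (B.subtype hBH).exists_conj_mem (U := (Subgroup.zpowers x).subgroupOf H)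
      (hxp.comap_of_injective H.subtype (Subgroup.subtype_injective _))
    exact ⟨g, g.2, hg ⟨x, hx⟩ (Subgroup.mem_zpowers x)⟩
  refine ⟨fun h => hH ?_, ?_, ?_⟩
  · refine eq_top_iff.2 fun x _ => ?_
    rw [← hmem, h]
    trivial
  · obtain ⟨b, hb, hbI⟩ := SetLike.exists_of_lt hIB
    let y : H.map (QuotientGroup.mk' I) := ⟨QuotientGroup.mk' I b, (hmem b).2 (hBH hb)⟩
    have hy : y ≠ 1 := by
      intro h
      have := congrArg Subtype.val h
      change QuotientGroup.mk' I b = 1 at this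
      rw [← MonoidHom.mem_ker, QuotientGroup.ker_mk'] at this
      exact hbI this
    obtain ⟨k, hk⟩ := B.isPGroup' ⟨b, hb⟩
    have hyk : y ^ p ^ k = 1 := by
      refine Subtype.ext ?_
      change (QuotientGroup.mk' I b) ^ p ^ k = 1
      rw [← map_pow]
      have := congrArg Subtype.val hk
      change b ^ p ^ k = 1 at this
      rw [this, map_one]
    obtain ⟨j, -, hj⟩ := (Nat.dvd_prime_pow Fact.out).1 (orderOf_dvd_of_pow_eq_one hyk)
    refine dvd_trans ?_ (orderOf_dvd_natCard y)
    rw [hj]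
    refine dvd_pow_self p ?_
    rintro rfl
    rw [pow_zero, orderOf_eq_one_iff] at hj
    exact hy hj
  · intro gb hgb hdvd
    obtain ⟨g, rfl⟩ := QuotientGroup.mk'_surjective I gb
    obtain ⟨⟨xb, hx1, hx2⟩, hord⟩ := exists_prime_orderOf_dvd_card' p hdvd
    obtain ⟨x, rfl⟩ := QuotientGroup.mk'_surjective I xb
    have hxpow : (QuotientGroup.mk' I x) ^ p = 1 := by
      have := pow_orderOf_eq_one (⟨QuotientGroup.mk' I x, hx1, hx2⟩ :
        (H.map (QuotientGroup.mk' I) ⊓ (H.map (QuotientGroup.mk' I)).map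
          (MulAut.conj (QuotientGroup.mk' I g)).toMonoidHom : Subgroup (G ⧸ I)))
      rw [hord] at this
      exact congrArg Subtype.val this
    have hxI : x ∉ I := by
      intro h
      rw [← QuotientGroup.ker_mk' I, MonoidHom.mem_ker] at h
      rw [← Subgroup.orderOf_coe] at hord
      change orderOf (QuotientGroup.mk' I x) = p at hord
      rw [h, orderOf_one] at hord
      exact (Fact.out : p.Prime).one_lt.ne hord
    have hxH : x ∈ H := (hmem x).1 hx1
    have hgx : g⁻¹ * x * g ∈ H := by
      obtain ⟨_, ⟨y, hy, rfl⟩, hyx⟩ := hx2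
      rw [← hmem]
      have : QuotientGroup.mk' I (g⁻¹ * x * g) = QuotientGroup.mk' I y := by
        simp only [map_mul, map_inv, ← hyx]
        simp [mul_assoc]
      rw [this, hmem]
      exact hy
    obtain ⟨h, hh, hhx⟩ := hconj x hxH (isPGroup_zpowers_of_quotient hI hxpow)
    obtain ⟨h', hh', hhx'⟩ := hconj _ hgx (isPGroup_zpowers_of_quotient hI (by
      simp only [map_mul, map_inv]
      have := conj_pow (a := (QuotientGroup.mk' I g)⁻¹) (b := QuotientGroup.mk' I x) (i := p)
      rw [hxpow, inv_inv] at this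
      rw [this]
      group))
    -- Both x and g⁻¹xg are p-elements of H, so elements h and h' of H conjugate them into the Sylow
    -- subgroup B. The element h'g⁻¹h⁻¹ carries one result to the other, hence lies in H, and
    -- therefore g does.
    have := key (h' * g⁻¹ * h⁻¹) (h * x * h⁻¹) hhx
      (fun hc => hxI (by simpa [mul_assoc] using ‹I.Normal›.conj_mem _ hc h⁻¹))
      (by convert hhx' using 1; group)
    refine hgb ((hmem g).2 ?_)
    have h2 := H.mul_mem (H.mul_mem (H.inv_mem hh') this) hh
    have h3 : h'⁻¹ * (h' * g⁻¹ * h⁻¹) * h = g⁻¹ := by group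
    rw [h3] at h2
    exact H.inv_mem_iff.1 h2

theorem IsPGroup.exists_mem_normalizer {p : ℕ} [Fact p.Prime] {S : Type*} [Group S] [Finite S]
    (hS : IsPGroup p S) {A E : Subgroup S} (h : A < E) :
    ∃ x ∈ E, x ∉ A ∧ x ∈ Subgroup.normalizer (A : Set S) := by
  have hE : IsPGroup p E := hS.to_subgroup E
  have := hE.isNilpotent
  have hlt : A.subgroupOf E < ⊤ := by
    refine lt_top_iff_ne_top.2 fun hc => h.not_ge ?_
    rwa [Subgroup.subgroupOf_eq_top] at hc
  obtain ⟨x, hx, hxA⟩ := SetLike.exists_of_lt (Group.normalizerCondition_of_isNilpotent _ hlt)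
  refine ⟨x, x.2, fun hc => hxA hc, ?_⟩
  rw [← Subgroup.subgroupOf_normalizer_eq h.le] at hx
  exact hx

theorem IsPGroup.lt_normalizer {p : ℕ} [Fact p.Prime] {S : Type*} [Group S] [Finite S]
    (hS : IsPGroup p S) {A : Subgroup S} (h : A ≠ ⊤) :
    A < Subgroup.normalizer (A : Set S) := by
  obtain ⟨x, -, hxA, hx⟩ := hS.exists_mem_normalizer (lt_top_iff_ne_top.2 h)
  exact SetLike.lt_iff_le_and_exists.2 ⟨Subgroup.le_normalizer, x, hx, hxA⟩

theorem Subgroup.card_lt_card_of_lt {S : Type*} [Group S] [Finite S] {A B : Subgroup S}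
    (h : A < B) : Nat.card A < Nat.card B :=
  (Subgroup.card_le_of_le h.le).lt_of_ne fun hc =>
    h.ne (Subgroup.eq_of_le_of_card_ge h.le hc.ge)

/-! ### Alperin's fusion theorem away from P -/

namespace FusionSystem

variable {S : Type*} [Group S] {F : FusionSystem S}

/-- `A` is `F`-conjugate to a subgroup of `P`. -/
def SubConj (F : FusionSystem S) (A P : Subgroup S) : Prop := ∃ f, F.Mor f A ∧ img f A ≤ P

theorem SubConj.mono {A B P : Subgroup S} (h : F.SubConj B P) (hAB : A ≤ B) : F.SubConj A P := by
  obtain ⟨f, hf, hfP⟩ := h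
  exact ⟨f, hf.restrict hAB, (img_mono f hAB).trans hfP⟩

theorem SubConj.of_mor {A P : Subgroup S} {f : S → S} (hf : F.Mor f A)
    (h : F.SubConj (img f A) P) : F.SubConj A P := by
  obtain ⟨g, hg, hgP⟩ := h
  exact ⟨g ∘ f, hg.comp hf le_rfl, (hf.img_comp g).trans_le hgP⟩

protected theorem SubConj.img {A P : Subgroup S} {f : S → S} (hf : F.Mor f A)
    (h : F.SubConj A P) : F.SubConj (img f A) P := by
  obtain ⟨g, hg, -, hgA⟩ := hf.inv
  exact .of_mor hg (by rwa [hgA])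

theorem SubConj.card_le [Finite S] {A P : Subgroup S} (h : F.SubConj A P) :
    Nat.card A ≤ Nat.card P := by
  obtain ⟨g, hg, hgP⟩ := h
  rw [← hg.card_img]
  exact Subgroup.card_le_of_le hgP

theorem isSCentric_iff {A : Subgroup S} :
    IsSCentric A ↔ Subgroup.centralizer (A : Set S) ≤ A := by
  unfold IsSCentric
  constructor
  · intro h
    rw [h]
    exact Subgroup.map_subtype_le _
  · intro h
    ext x
    rw [Subgroup.mem_map]
    constructor
    · intro hx
      refine ⟨⟨x, h hx⟩, Subgroup.mem_center_iff.2 fun y => Subtype.ext ?_, rfl⟩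
      exact Subgroup.mem_centralizer_iff.1 hx y y.2
    · rintro ⟨x, hx, rfl⟩
      rw [Subgroup.mem_center_iff] at hx
      exact Subgroup.mem_centralizer_iff.2 fun y hy => congrArg Subtype.val (hx ⟨y, hy⟩)

/-- The normalizer of each conjugate embeds in the normalizer of R, by `exists_mor_normalizer`. -/
theorem isFullyNormalized_of_isReceptive [Finite S] {p : ℕ} [Fact p.Prime] (hS : IsPGroup p S)
    {R : Subgroup S} (ha : F.IsFullyAutomized p R) (hr : F.IsReceptive R) :
    F.IsFullyNormalized R := by
  intro Q hQ
  obtain ⟨f, hf, rfl⟩ := isConj_iff.1 hQ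
  obtain ⟨g, hg, -, hgR⟩ := hf.inv
  obtain ⟨k, hk, hkR⟩ := exists_mor_normalizer hS ha hr hg hgR
  rw [← hk.card_img]
  refine Subgroup.card_le_of_le ?_
  have := hk.img_normalizer_le
  rwa [hkR] at this

/-- The strongly embedded subgroup is the image of Aut_G(R). An automorphism a that conjugates a
noninner element of Aut_S(R) into Aut_S(R) has N_a strictly above R, so it lies in G by `hext`; this
is the fusion control required by `isStronglyEmbedded_map_mk`. -/
theorem isStronglyEmbedded_of_autF_lt [Finite S] {p : ℕ} [Fact p.Prime] (hS : IsPGroup p S)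
    {G : FusionSystem S} {R : Subgroup S} (hR : R ≠ ⊤) (hRC : IsSCentric R)
    (ha : F.IsFullyAutomized p R)
    (hext : ∀ a, F.Mor a R → img a R = R → ∀ y, Ctrl a R y → y ∉ R → G.Mor a R)
    (hne : ¬ F.autF R ≤ G.autF R) :
    ∃ H : Subgroup (F.outF R), IsStronglyEmbedded p H := by
  rw [isSCentric_iff] at hRC
  obtain ⟨B, hB⟩ := ha
  have hinn : innAut R ≤ autS R := by
    rintro _ ⟨x, rfl⟩
    exact mem_autS_iff.2 ⟨x, Subgroup.le_normalizer x.2, fun y => by simp⟩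
  refine ⟨_, isStronglyEmbedded_map_mk ((innAut R).subgroupOf (F.autF R)) ?_ B ?_
    ((G.autF R).subgroupOf (F.autF R)) ?_ ?_ ?_⟩
  · exact ((hS.to_subgroup R).of_surjective (MulAut.conj : R →* MulAut R).rangeRestrict
      (MonoidHom.rangeRestrict_surjective _)).comap_of_injective _ (Subgroup.subtype_injective _)
  · rw [hB]
    refine SetLike.lt_iff_le_and_exists.2 ⟨fun a ha => hinn ha, ?_⟩
    obtain ⟨n, hn, hnR⟩ := SetLike.exists_of_lt (hS.lt_normalizer hR)
    let c : MulAut R := Subgroup.normalizerMonoidHom R ⟨n, hn⟩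
    refine ⟨⟨c, autS_le_autF R ⟨_, rfl⟩⟩, ⟨_, rfl⟩, ?_⟩
    rintro ⟨q, hq⟩
    refine hnR ?_
    -- If n acted on R as some q in R does, then q⁻¹n would centralize R and so lie in R, forcing n
    -- into R.
    have h1 : (q : S)⁻¹ * n ∈ R := by
      refine hRC (Subgroup.mem_centralizer_iff.2 fun y hy => ?_)
      have h2 := congrArg Subtype.val (DFunLike.congr_fun hq ⟨y, hy⟩)
      have h3 : (q : S) * y * (q : S)⁻¹ = n * y * n⁻¹ := by simpa [c] using h2
      have h4 : y = (q : S)⁻¹ * (n * y * n⁻¹) * q := by rw [← h3]; group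
      calc y * ((q : S)⁻¹ * n) = ((q : S)⁻¹ * (n * y * n⁻¹) * q) * ((q : S)⁻¹ * n) := by rw [← h4]
        _ = (q : S)⁻¹ * n * y := by group
    have := R.mul_mem q.2 h1
    rwa [mul_inv_cancel_left] at this
  · rw [hB]
    exact fun a ha => autS_le_autF (F := G) R ha
  · intro h
    rw [Subgroup.subgroupOf_eq_top] at h
    exact hne h
  · intro a u hu huI hau
    rw [← SetLike.mem_coe, ← Sylow.coe_coe, SetLike.mem_coe, hB, Subgroup.mem_subgroupOf,
      mem_autS_iff] at hu hau
    obtain ⟨n, hn, hun⟩ := hu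
    obtain ⟨m, hm, hum⟩ := hau
    obtain ⟨f, hf⟩ := exists_fun (a : MulAut R)
    have hfR : img f R = R := img_eq_of_mulEquiv (a : MulAut R) hf
    have hfM := (mem_autF_iff hf).1 a.2
    refine Subgroup.mem_subgroupOf.2 ((mem_autF_iff hf).2 (hext f hfM hfR n ⟨hn, m, hfR.symm ▸ hm,
      fun x hx => ?_⟩ fun hnR => ?_))
    · have h1 := hum (a.1 ⟨x, hx⟩)
      have h2 : ((a * u * a⁻¹ : F.autF R) : MulAut R) (a.1 ⟨x, hx⟩) = a.1 (u.1 ⟨x, hx⟩) := by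
        change a.1 (u.1 (a.1⁻¹ (a.1 ⟨x, hx⟩))) = _
        rw [MulAut.inv_apply_self]
      rw [h2, hf, hf, hun] at h1
      exact h1
    · refine huI ⟨⟨n, hnR⟩, ?_⟩
      ext x
      simp [hun]

/-- **Alperin's fusion theorem**, relative to a subgroup `P`: morphisms on subgroups that are not
`F`-conjugate to a subgroup of `P` are generated without the automorphisms of `P`. -/
theorem generate_mor_of_not_subConj [Finite S] {p : ℕ} [Fact p.Prime] (hS : IsPGroup p S)
    (hF : F.IsSaturated p) {C : Set (Subgroup S)} (hC : F.IsEssentialReps p C) (P : Subgroup S)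
    {Q : Subgroup S} (hQ : ¬ F.SubConj Q P) {f : S → S} (hf : F.Mor f Q) :
    (generate (F.automizers (insert ⊤ (C \ {P})))).Mor f Q := by
  set G := generate (F.automizers (insert ⊤ (C \ {P}))) with hG
  -- Induction on decreasing order of Q: every larger subgroup not conjugate into P is already
  -- settled.
  induction hn : Nat.card S - Nat.card Q using Nat.strong_induction_on generalizing Q f with
  | _ n ih =>
  replace ih : ∀ Q' : Subgroup S, Nat.card Q < Nat.card Q' → ¬ F.SubConj Q' P → ∀ f, F.Mor f Q' →
      G.Mor f Q' := by
    intro Q' hc hQ' f hf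
    have := Subgroup.card_le_card_group Q'
    exact ih _ (by omega) hQ' hf rfl
  by_cases hQt : Q = ⊤
  · subst hQt
    refine generate_mor (Set.mem_insert _ _) hf ?_
    exact Subgroup.eq_top_of_card_eq _ (by rw [hf.card_img, Subgroup.card_top])
  obtain ⟨R, hQR, ha, hr⟩ := hF Q
  obtain ⟨f₁, hf₁, hf₁R⟩ := isConj_iff.1 hQR
  have hcard : Nat.card R = Nat.card Q := by rw [← hf₁R, hf₁.card_img]
  have hRP : ¬ F.SubConj R P := fun h => hQ (.of_mor hf₁ (hf₁R.symm ▸ h))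
  have hRt : R ≠ ⊤ := by
    rintro rfl
    exact hQt (Subgroup.eq_top_of_card_eq _ (by rw [← hcard, Subgroup.card_top]))
  -- Every conjugate reaches R by a G-morphism, since the F-morphism can be chosen to extend to the
  -- strictly larger normalizer.
  have hnorm : ∀ (A : Subgroup S) (g : S → S), F.Mor g A → img g A = R →
      ∃ k, G.Mor k A ∧ img k A = R := by
    intro A g hg hgA
    have hcA : Nat.card A = Nat.card R := by rw [← hgA, hg.card_img]
    obtain ⟨k, hk, hkA⟩ := exists_mor_normalizer hS ha hr hg hgA
    have hA : A < Subgroup.normalizer (A : Set S) := by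
      refine hS.lt_normalizer ?_
      rintro rfl
      exact hRt (Subgroup.eq_top_of_card_eq _ (by rw [← hcA, Subgroup.card_top]))
    refine ⟨k, (ih _ ?_ ?_ k hk).restrict hA.le, hkA⟩
    · rw [← hcard, ← hcA]
      exact Subgroup.card_lt_card_of_lt hA
    · intro h
      exact hRP (hgA ▸ (h.mono hA.le).img hg)
  have hext : ∀ a, F.Mor a R → img a R = R → ∀ y, Ctrl a R y → y ∉ R → G.Mor a R := by
    intro a haM haR y hy hyR
    obtain ⟨N, hN, k, hk, hkx⟩ := isReceptive_iff.1 hr R a haM haR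
    have hRN : R < N := SetLike.lt_iff_le_and_exists.2
      ⟨fun x hx => (hN x).2 (haM.ctrl_of_mem hx), y, (hN y).2 hy, hyR⟩
    have := ih N (hcard ▸ Subgroup.card_lt_card_of_lt hRN) (fun h => hRP (h.mono hRN.le)) k hk
    exact (this.restrict hRN.le).congr hkx
  have hAut : ∀ a, F.Mor a R → img a R = R → G.Mor a R := by
    by_cases hcent : F.IsCentric R
    · by_cases hle : F.autF R ≤ G.autF R
      · intro a haM haR
        obtain ⟨e, he, hea⟩ := haM.equiv haR
        exact (mem_autF_iff (a := e) hea).1 (hle he)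
      · have hess : F.IsEssential p R :=
          ⟨lt_top_iff_ne_top.2 hRt, hcent, isFullyNormalized_of_isReceptive hS ha hr,
            isStronglyEmbedded_of_autF_lt hS hRt (hcent R (isConj_iff.2 ⟨id, mor_id F R, img_id R⟩))
              ha hext hle⟩
        obtain ⟨E, ⟨hEC, hRE⟩, -⟩ := hC.2 R hess
        obtain ⟨g, hg, hgE⟩ := isConj_iff.1 hRE
        have hEP : E ≠ P := by
          rintro rfl
          exact hRP ⟨g, hg, hgE.le⟩
        obtain ⟨g', hg', -, hg'R⟩ := hg.inv
        rw [hgE] at hg' hg'R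
        obtain ⟨k, hk, hkR⟩ := hnorm E g' hg' hg'R
        obtain ⟨l, hl, hlx, hlE⟩ := hk.inv
        rw [hkR] at hl hlE
        intro a haM haR
        have hk' := hk.of_generate
        have hl' := hl.of_generate
        have hm1 : F.Mor (a ∘ k) E := haM.comp hk' hkR.le
        have hi1 : img (a ∘ k) E = R := by rw [hk'.img_comp, hkR, haR]
        have hm2 : F.Mor (l ∘ (a ∘ k)) E := hl'.comp hm1 hi1.le
        have hi2 : img (l ∘ (a ∘ k)) E = E := by rw [hm1.img_comp, hi1, hlE]
        have hm3 : G.Mor (l ∘ (a ∘ k)) E :=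
          generate_mor (Set.mem_insert_of_mem _ (show E ∈ C \ {P} from ⟨hEC, hEP⟩)) hm2 hi2
        have hm4 : G.Mor (k ∘ ((l ∘ (a ∘ k)) ∘ l)) R := by
          refine hk.comp (hm3.comp hl hlE.le) ?_
          rw [hl.img_comp, hlE, hi2]
        have hkl : ∀ y ∈ R, k (l y) = y := by
          intro y hy
          rw [← hkR] at hy
          obtain ⟨x, hx, rfl⟩ := hk.mem_img.1 hy
          rw [hlx x hx]
        refine hm4.congr fun x hx => ?_
        simp only [Function.comp_apply]
        rw [hkl x hx, hkl]
        exact haR ▸ apply_mem_img a hx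
    · intro a haM haR
      unfold IsCentric at hcent
      push Not at hcent
      obtain ⟨Q', hQ', hQ'c⟩ := hcent
      rw [isSCentric_iff, SetLike.not_le_iff_exists] at hQ'c
      obtain ⟨x, hx, hxQ'⟩ := hQ'c
      obtain ⟨g, hg, rfl⟩ := isConj_iff.1 hQ'
      obtain ⟨g', hg', -, hg'R⟩ := hg.inv
      -- For R not centric, some conjugate has a centralizing element x outside it. Receptivity of R
      -- carries x to an element of C_S(R) outside R, which lies in N_a for every automorphism a of
      -- R; hence every a extends properly.
      obtain ⟨N, hN, k, hk, hkx⟩ := isReceptive_iff.1 hr _ g' hg' hg'R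
      have hQN : img g R ≤ N := fun x hx => (hN x).2 (hg'.ctrl_of_mem hx)
      have hxN : x ∈ N := (hN x).2 (ctrl_of_mem_centralizer hx)
      have hkR : img k (img g R) = R := by rw [img_congr hkx, hg'R]
      refine hext a haM haR (k x) (ctrl_of_mem_centralizer ?_) ?_
      · have := hk.centralizer_mem hQN hxN hx
        rwa [hkR] at this
      · intro h
        rw [← hkR, hk.mem_img_iff hQN hxN] at h
        exact hxQ' h
  obtain ⟨k₁, hk₁, hk₁R⟩ := hnorm Q f₁ hf₁ hf₁R
  obtain ⟨i, hi, hix, hiQ⟩ := hf.inv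
  obtain ⟨k₂, hk₂, hk₂R⟩ := hnorm (img f Q) (f₁ ∘ i) (hf₁.comp hi hiQ.le)
    (by rw [hi.img_comp, hiQ, hf₁R])
  obtain ⟨l₁, hl₁, hl₁x, hl₁Q⟩ := hk₁.inv
  obtain ⟨l₂, hl₂, hl₂x, hl₂Q⟩ := hk₂.inv
  rw [hk₁R] at hl₁ hl₁Q
  rw [hk₂R] at hl₂ hl₂Q
  have hm1 : F.Mor (f ∘ l₁) R := hf.comp hl₁.of_generate hl₁Q.le
  have hi1 : img (f ∘ l₁) R = img f Q := by rw [hl₁.img_comp, hl₁Q]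
  have hm2 : F.Mor (k₂ ∘ (f ∘ l₁)) R := hk₂.of_generate.comp hm1 hi1.le
  have hi2 : img (k₂ ∘ (f ∘ l₁)) R = R := by rw [hm1.img_comp, hi1, hk₂R]
  -- Conjugating f by G-isomorphisms onto R turns it into an automorphism of R.
  have hm3 : G.Mor (k₂ ∘ (f ∘ l₁)) R := hAut _ hm2 hi2
  have hm4 : G.Mor (l₂ ∘ ((k₂ ∘ (f ∘ l₁)) ∘ k₁)) Q := by
    refine hl₂.comp (hm3.comp hk₁ hk₁R.le) ?_
    rw [hk₁.img_comp, hk₁R, hi2]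
  refine hm4.congr fun x hx => ?_
  simp only [Function.comp_apply]
  rw [hl₁x x hx, hl₂x _ (apply_mem_img f hx)]

end FusionSystem

/-! ### A saturation criterion for the generated subsystem -/

namespace FusionSystem

variable {S : Type*} [Group S] {F : FusionSystem S} {D : Set (Subgroup S)}

/-- In each step, E contains the normalizer of the current image, and the extension built so far
maps the original normalizer into that normalizer. So the next automorphism of E can be applied to
it. -/
theorem Reach.exists_extension {Y : Set (Subgroup S)}
    (hY : ∀ R ∈ Y, ∀ E ∈ D, R ≤ E → Subgroup.normalizer (R : Set S) ≤ E ∧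
      ∀ a, F.Mor a E → img a E = E → img a R ∈ Y)
    {R : Subgroup S} (hR : R ∈ Y) {f : S → S} (hf : Reach F D R f) :
    img f R ∈ Y ∧ ∃ k, (generate (F.automizers D)).Mor k (Subgroup.normalizer (R : Set S)) ∧
      ∀ x ∈ R, k x = f x := by
  induction hf with
  | refl => exact ⟨(img_id R).symm ▸ hR, id, mor_id _ _, fun _ _ => rfl⟩
  | @step f a E hf hE ha haE hfE ih =>
    obtain ⟨hfY, k, hk, hkx⟩ := ih
    obtain ⟨h1, h2⟩ := hY _ hfY E hE ((img_le_iff f).2 hfE)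
    refine ⟨(hf.mor.img_comp a) ▸ h2 a ha haE, a ∘ k, ?_, fun x hx => ?_⟩
    · refine (generate_mor hE ha haE).comp hk ?_
      have := hk.img_normalizer_le
      rw [img_congr hkx] at this
      exact this.trans h1
    · simp [hkx x hx]

theorem Mor.exists_extension (hD : ⊤ ∈ D) {Y : Set (Subgroup S)}
    (hY : ∀ R ∈ Y, ∀ E ∈ D, R ≤ E → Subgroup.normalizer (R : Set S) ≤ E ∧
      ∀ a, F.Mor a E → img a E = E → img a R ∈ Y)
    {R : Subgroup S} (hR : R ∈ Y) {f : S → S} (hf : (generate (F.automizers D)).Mor f R) :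
    img f R ∈ Y ∧ ∃ k, (generate (F.automizers D)).Mor k (Subgroup.normalizer (R : Set S)) ∧
      ∀ x ∈ R, k x = f x := by
  obtain ⟨g, hg, hfg⟩ := hf.reach hD
  obtain ⟨h1, k, hk, hkx⟩ := hg.exists_extension hY hR
  exact ⟨img_congr hfg ▸ h1, k, hk, fun x hx => by rw [hkx x hx, hfg x hx]⟩

/-- A criterion for the saturation axiom of a generated subsystem to hold on a class `K` of
subgroups closed under `F`-conjugation. All morphisms of the subsystem on members of `Y` extend to
the normalizer, while members of `K` outside `Y` can be moved, together with their normalizers, to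
subgroups whose normalizer has the same morphisms in both systems. -/
theorem exists_isReceptive_generate [Finite S] {p : ℕ} [Fact p.Prime] (hS : IsPGroup p S)
    (hF : F.IsSaturated p) {C : Set (Subgroup S)} (hC : F.IsEssentialReps p C) (P : Subgroup S)
    {G : FusionSystem S} (hG : G = generate (F.automizers (insert ⊤ (C \ {P}))))
    {K Y : Set (Subgroup S)} (hK : ∀ R ∈ K, ∀ f, F.Mor f R → img f R ∈ K)
    (hY : ∀ R ∈ Y, ∀ E ∈ insert ⊤ (C \ {P}), R ≤ E → Subgroup.normalizer (R : Set S) ≤ E ∧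
      ∀ a, F.Mor a E → img a E = E → img a R ∈ Y)
    (hKY : ∀ R ∈ K, R ∉ Y → ∃ χ, G.Mor χ (Subgroup.normalizer (R : Set S)) ∧
      ¬ F.SubConj (Subgroup.normalizer (img χ R : Set S)) P ∧
      ∀ f, F.Mor f (img χ R) → ∀ N : Subgroup S, (∀ g, g ∈ N ↔ Ctrl f (img χ R) g) →
        F.SubConj N P → N = img χ R)
    (hA : ∀ R ∈ K, R ∈ Y → G.IsFullyAutomized p R) {Q : Subgroup S} (hQ : Q ∈ K) :
    ∃ R, G.IsConj Q R ∧ G.IsFullyAutomized p R ∧ G.IsReceptive R := by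
  subst hG
  set G := generate (F.automizers (insert ⊤ (C \ {P}))) with hG
  have hD : ⊤ ∈ insert ⊤ (C \ {P}) := Set.mem_insert _ _
  by_cases hQY : Q ∈ Y
  · refine ⟨Q, isConj_iff.2 ⟨id, mor_id _ _, img_id Q⟩, hA Q hQ hQY, isReceptive_iff.2 ?_⟩
    intro A f hf hfA
    obtain ⟨e, he, hef⟩ := hf.equiv hfA
    obtain ⟨i, hi, -, hiA⟩ := hf.inv
    rw [hfA] at hi hiA
    have hAY : A ∈ Y := hiA ▸ (hi.exists_extension hD hY hQY).1
    obtain ⟨-, k, hk, hkx⟩ := hf.exists_extension hD hY hAY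
    exact ⟨extControl e, mem_extControl_iff e hef, k,
      hk.restrict fun g hg => ((mem_extControl_iff e hef g).1 hg).1, hkx⟩
  · obtain ⟨R, hQR, hRa, hRr⟩ := hF Q
    obtain ⟨f₀, hf₀, hf₀R⟩ := isConj_iff.1 hQR
    obtain ⟨χ, hχ, hχn, -⟩ := hKY Q hQ hQY
    have hχQ := hχ.restrict Subgroup.le_normalizer
    obtain ⟨i, hi, hix, hiQ⟩ := hχQ.inv
    obtain ⟨k, hk, hkR⟩ := exists_mor_normalizer hS hRa hRr (hf₀.comp hi.of_generate hiQ.le)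
      (by rw [hi.img_comp, hiQ, hf₀R])
    -- The normalizer of χ(Q) is not conjugate into P, so the F-morphism carrying it into S is in G.
    -- This makes R conjugate to Q in G, and not only in F.
    have hkG : G.Mor k (img χ Q) :=
      (generate_mor_of_not_subConj hS hF hC P hχn hk).restrict Subgroup.le_normalizer
    have hkχ : G.Mor (k ∘ χ) Q := hkG.comp hχQ le_rfl
    have hkχR : img (k ∘ χ) Q = R := by rw [hχQ.img_comp, hkR]
    obtain ⟨j, hj, -, hjQ⟩ := hkχ.inv
    rw [hkχR] at hj hjQ
    have hRY : R ∉ Y := fun h => hQY (hjQ ▸ (hj.exists_extension hD hY h).1)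
    have hRK : R ∈ K := hf₀R ▸ hK Q hQ f₀ hf₀
    refine ⟨R, isConj_iff.2 ⟨_, hkχ, hkχR⟩, hRa.mono (autF_generate_le R), isReceptive_iff.2 ?_⟩
    intro A f hf hfA
    obtain ⟨e, he, hef⟩ := hf.equiv hfA
    obtain ⟨f', hf', hf'x, hf'A⟩ := hf.inv
    rw [hfA] at hf' hf'A
    have hAY : A ∉ Y := fun h => hRY (hfA ▸ (hf.exists_extension hD hY h).1)
    have hAK : A ∈ K := hf'A ▸ hK R hRK f' hf'.of_generate
    obtain ⟨θ, hθ, hθn, hθN⟩ := hKY A hAK hAY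
    have hθA := hθ.restrict Subgroup.le_normalizer
    obtain ⟨l, hl, hlx, hlA⟩ := hθA.inv
    have hfl : G.Mor (f ∘ l) (img θ A) := hf.comp hl hlA.le
    have hflR : img (f ∘ l) (img θ A) = R := by rw [hl.img_comp, hlA, hfA]
    obtain ⟨N, hN, m, hm, hmx⟩ := isReceptive_iff.1 hRr _ _ hfl.of_generate hflR
    have hmG : G.Mor m N := by
      -- Either N is conjugate into P, and then it equals θ(A) and there is nothing to extend, or
      -- the extension belongs to G by Alperin's theorem.
      by_cases hNP : F.SubConj N P
      · have := hθN _ hfl.of_generate N hN hNP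
        subst this
        exact hfl.congr fun x hx => (hmx x hx).symm
      · exact generate_mor_of_not_subConj hS hF hC P hNP hm
    refine ⟨extControl e, mem_extControl_iff e hef, m ∘ θ, ?_, fun x hx => ?_⟩
    -- Since θ is defined on the whole normalizer of A, it carries N_f into N.
    · refine hmG.comp (hθ.restrict fun g hg => ((mem_extControl_iff e hef g).1 hg).1) ?_
      rw [img_le_iff]
      intro g hg
      obtain ⟨hgn, h, hh, hhx⟩ := (mem_extControl_iff e hef g).1 hg
      rw [hN]
      refine ⟨hθ.normalizer_mem Subgroup.le_normalizer hgn hgn, h, ?_, fun y hy => ?_⟩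
      · rwa [hflR, ← hfA]
      · obtain ⟨x, hx, rfl⟩ := hθA.mem_img.1 hy
        have hgx : g * x * g⁻¹ ∈ A := (Subgroup.mem_normalizer_iff.1 hgn x).1 hx
        rw [← hθ.map_conj hgn (Subgroup.le_normalizer hx)]
        simp only [Function.comp_apply]
        rw [hlx _ hgx, hlx x hx, hhx x hx]
    · simp only [Function.comp_apply]
      rw [hmx _ (apply_mem_img θ hx), Function.comp_apply, hlx x hx]

end FusionSystem

open scoped Pointwise

/-! ### Automorphisms of groups of order p² and p³ -/

section SmallGroups

theorem mul_comm_of_sup_center_eq_top {X : Type*} [Group X] {L : Subgroup X} (hL : L ⊔ Subgroup.center X = ⊤)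
    (hcomm : ∀ a b : L, a * b = b * a) (x y : X) : x * y = y * x := by
  have hx : x ∈ L ⊔ Subgroup.center X := hL ▸ Subgroup.mem_top x
  have hy : y ∈ L ⊔ Subgroup.center X := hL ▸ Subgroup.mem_top y
  rw [Subgroup.mem_sup_of_normal_right] at hx hy
  obtain ⟨v, hv, z, hz, rfl⟩ := hx
  obtain ⟨w, hw, t, ht, rfl⟩ := hy
  rw [Subgroup.mem_center_iff] at hz ht
  have hvw : v * w = w * v := congrArg Subtype.val (hcomm ⟨v, hv⟩ ⟨w, hw⟩)
  calc v * z * (w * t) = v * (w * z) * t := by rw [hz w]; group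
    _ = w * v * (z * t) := by rw [← hvw]; group
    _ = w * v * (t * z) := by rw [hz t]
    _ = w * (t * v) * z := by rw [← ht v]; group
    _ = w * t * (v * z) := by group

variable {p : ℕ} [Fact p.Prime] {X : Type*} [Group X]

theorem Subgroup.index_eq_of_card_eq {V : Subgroup X} {n : ℕ} (hX : Nat.card X = p ^ (n + 1))
    (hV : Nat.card V = p ^ n) : V.index = p := by
  have h1 := V.card_mul_index
  rw [hV, hX] at h1
  exact Nat.eq_of_mul_eq_mul_left (pow_pos (Fact.out : p.Prime).pos n) (by rw [h1]; ring)

/-- The center is nontrivial and the central quotient of a non-abelian group is not cyclic. -/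
theorem card_center_of_card_eq_cube (hX : Nat.card X = p ^ 3) (hne : ¬ ∀ x y : X, x * y = y * x) :
    Nat.card (Subgroup.center X) = p := by
  have hp : p.Prime := Fact.out
  obtain ⟨k, hk, hkc⟩ := IsPGroup.card_center_eq_prime_pow hX (by norm_num)
  have h1 := (Subgroup.center X).card_mul_index
  rw [hkc, hX] at h1
  have hk3 : k ≤ 3 := by
    rw [← Nat.pow_dvd_pow_iff_le_right hp.one_lt, ← h1]
    exact dvd_mul_right _ _
  have hcyc : IsCyclic (X ⧸ Subgroup.center X) → False := fun _ =>
    hne (isMulCommutative_of_isCyclic_quotient_center_self X).is_comm.comm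
  interval_cases k
  · simpa using hkc
  · refine (hcyc (isCyclic_of_prime_card (p := p) ?_)).elim
    change (Subgroup.center X).index = p
    exact Nat.eq_of_mul_eq_mul_left (pow_pos hp.pos 2) (by rw [h1]; ring)
  · refine (hcyc (isCyclic_of_card_dvd_prime (p := p) ?_)).elim
    change (Subgroup.center X).index ∣ p
    have : (Subgroup.center X).index = 1 :=
      Nat.eq_of_mul_eq_mul_left (pow_pos hp.pos 3) (by rw [h1]; ring)
    simp [this]

variable [Finite X]

theorem IsPGroup.pow_succ_le_card (hX : IsPGroup p X) {B : Subgroup X} {k : ℕ}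
    (h : p ^ k < Nat.card B) : p ^ (k + 1) ≤ Nat.card B := by
  obtain ⟨n, hn⟩ := IsPGroup.iff_card.1 (hX.to_subgroup B)
  rw [hn] at h ⊢
  have := (Nat.pow_lt_pow_iff_right (Fact.out : p.Prime).one_lt).1 h
  exact Nat.pow_le_pow_right (Fact.out : p.Prime).pos this

theorem IsPGroup.exists_fixed_ne_one (hX : p ∣ Nat.card X) {U : Subgroup (MulAut X)}
    (hU : IsPGroup p U) : ∃ z : X, z ≠ 1 ∧ ∀ a ∈ U, a z = z := by
  obtain ⟨z, hz, hz1⟩ := hU.exists_fixed_point_of_prime_dvd_card_of_fixed_point X hX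
    (a := 1) (fun a => map_one (a : MulAut X))
  exact ⟨z, fun h => hz1 h.symm, fun a ha => hz ⟨a, ha⟩⟩

/-- A p-group acting on a set of p elements that fixes 1 fixes another point, and that point
generates. -/
theorem MulAut.apply_eq_self_of_card_eq_prime (hX : Nat.card X = p) {a : MulAut X} {k : ℕ}
    (ha : a ^ p ^ k = 1) (x : X) : a x = x := by
  obtain ⟨z, hz1, hz⟩ := (isPGroup_zpowers_of_pow_eq_one ha).exists_fixed_ne_one
    (X := X) (hX ▸ dvd_rfl)
  have hx : x ∈ Subgroup.zpowers z := by
    rw [zpowers_eq_top_of_prime_card hX hz1]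
    trivial
  obtain ⟨n, rfl⟩ := hx
  change a (z ^ n) = z ^ n
  rw [map_zpow, hz a (Subgroup.mem_zpowers a)]

theorem MulAut.inv_mul_apply_mem_of_index_eq_prime {M : Subgroup X} [M.Normal] (hM : M.index = p)
    {a : MulAut X} {k : ℕ} (ha : a ^ p ^ k = 1) (haM : a • M = M) (x : X) : x⁻¹ * a x ∈ M := by
  let b : MulAut (X ⧸ M) := QuotientGroup.congr M M a haM
  have hb : ∀ (n : ℕ) (x : X), (b ^ n) (x : X ⧸ M) = ((a ^ n) x : X) := by
    intro n
    induction n with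
    | zero => intro x; rfl
    | succ n ih =>
      intro x
      rw [pow_succ, pow_succ, MulAut.mul_apply, MulAut.mul_apply]
      exact ih (a x)
  have hbk : b ^ p ^ k = 1 := by
    ext x
    obtain ⟨x, rfl⟩ := QuotientGroup.mk_surjective x
    rw [hb, ha]
    rfl
  have := MulAut.apply_eq_self_of_card_eq_prime (X := X ⧸ M) hM hbk (x : X ⧸ M)
  exact QuotientGroup.eq.1 this.symm

theorem IsPGroup.card_le_one_of_card_dvd_prime (hX : Nat.card X ∣ p) {U : Subgroup (MulAut X)}
    (hU : IsPGroup p U) : Nat.card U ≤ 1 := by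
  rw [Nat.dvd_prime Fact.out] at hX
  have h : ∀ a ∈ U, a = 1 := by
    intro a ha
    ext x
    rcases hX with hX | hX
    · have := (Nat.card_eq_one_iff_unique.1 hX).1
      exact Subsingleton.elim _ _
    · obtain ⟨k, hk⟩ := hU ⟨a, ha⟩
      exact MulAut.apply_eq_self_of_card_eq_prime hX (congrArg Subtype.val hk) x
  rw [(Subgroup.eq_bot_iff_forall U).2 h, Subgroup.card_bot]

theorem Subgroup.eq_top_of_lt_of_index_eq_prime {M L : Subgroup X} (hM : M.index = p)
    (h : M < L) : L = ⊤ := by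
  have h1 := Subgroup.index_dvd_of_le h.le
  rw [hM, Nat.dvd_prime Fact.out] at h1
  rcases h1 with h1 | h1
  · exact Subgroup.index_eq_one.1 h1
  · exact absurd (Subgroup.eq_of_le_of_card_ge h.le (by
      have h2 := M.card_mul_index
      have h3 := L.card_mul_index
      rw [hM] at h2
      rw [h1, ← h2] at h3
      exact (Nat.eq_of_mul_eq_mul_right (Fact.out : p.Prime).pos h3).le)) h.ne

/-- A `p`-group of automorphisms of a group of order `p ^ 2` has order at most `p`. -/
theorem IsPGroup.card_le_of_card_eq_sq (hX : Nat.card X = p ^ 2) {U : Subgroup (MulAut X)}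
    (hU : IsPGroup p U) : Nat.card U ≤ p := by
  have hp : p.Prime := Fact.out
  have hcomm := (IsPGroup.isMulCommutative_of_card_eq_prime_sq hX).is_comm.comm
  obtain ⟨z, hz1, hz⟩ := hU.exists_fixed_ne_one (X := X) (hX ▸ dvd_pow_self p two_ne_zero)
  let N := Subgroup.zpowers z
  have hN : N.Normal := ⟨fun n hn g => by rwa [hcomm g n, mul_inv_cancel_right]⟩
  have hfix : ∀ a ∈ U, ∀ x ∈ N, a x = x := by
    rintro a ha _ ⟨n, rfl⟩
    change a (z ^ n) = z ^ n
    rw [map_zpow, hz a ha]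
  have hNcard : N = ⊤ ∨ N.index = p := by
    have h1 := N.index_dvd_card
    rw [hX, Nat.dvd_prime_pow hp] at h1
    obtain ⟨m, hm, h1⟩ := h1
    interval_cases m
    · exact .inl (Subgroup.index_eq_one.1 h1)
    · exact .inr (by simpa using h1)
    · have h2 := N.card_mul_index
      rw [h1, hX] at h2
      have h3 : Nat.card N = 1 := Nat.eq_of_mul_eq_mul_right (pow_pos hp.pos 2) (by simpa using h2)
      rw [Subgroup.card_eq_one, Subgroup.zpowers_eq_bot] at h3
      exact absurd h3 hz1
  rcases hNcard with hNt | hNi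
  · have : U = ⊥ := (Subgroup.eq_bot_iff_forall U).2 fun a ha => by
      ext x
      exact hfix a ha x (hNt ▸ Subgroup.mem_top x)
    rw [this, Subgroup.card_bot]
    exact hp.one_le
  · have hNc : Nat.card N = p := by
      have h2 := N.card_mul_index
      rw [hNi, hX, pow_two] at h2
      exact Nat.eq_of_mul_eq_mul_right hp.pos h2
    have hNt : N ≠ ⊤ := by
      intro h
      rw [h, Subgroup.index_top] at hNi
      exact hp.one_lt.ne hNi
    obtain ⟨x, -, hx⟩ := SetLike.exists_of_lt (lt_top_iff_ne_top.2 hNt)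
    have hmem : ∀ a : U, x⁻¹ * (a : MulAut X) x ∈ N := by
      intro a
      obtain ⟨k, hk⟩ := hU a
      refine MulAut.inv_mul_apply_mem_of_index_eq_prime hNi (congrArg Subtype.val hk) ?_ x
      ext y
      rw [Subgroup.mem_pointwise_smul_iff_inv_smul_mem]
      constructor
      · intro h
        have := hfix a a.2 _ h
        change (a : MulAut X) ((a : MulAut X)⁻¹ y) = _ at this
        rw [MulAut.apply_inv_self] at this
        rwa [this]
      · intro h
        change (a : MulAut X)⁻¹ y ∈ N
        rwa [hfix _ (U.inv_mem a.2) y h]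
    rw [← hNc]
    -- U acts trivially on N and on X/N, so a in U is determined by x⁻¹a(x) in N for a single x
    -- outside N.
    refine Nat.card_le_card_of_injective (fun a : U => (⟨_, hmem a⟩ : N)) fun a b hab => ?_
    have hab' : (a : MulAut X) x = (b : MulAut X) x := by simpa using hab
    have htop : MonoidHom.eqLocus (a : MulAut X).toMonoidHom (b : MulAut X).toMonoidHom = ⊤ := by
      refine Subgroup.eq_top_of_lt_of_index_eq_prime hNi (SetLike.lt_iff_le_and_exists.2 ⟨fun y hy => ?_, x, hab', hx⟩)
      exact (hfix a a.2 y hy).trans (hfix b b.2 y hy).symm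
    refine Subtype.ext (MulEquiv.ext fun y => ?_)
    have : y ∈ MonoidHom.eqLocus (a : MulAut X).toMonoidHom (b : MulAut X).toMonoidHom :=
      htop ▸ Subgroup.mem_top y
    exact this

theorem center_le_of_card_eq_sq (hX : Nat.card X = p ^ 3) (hne : ¬ ∀ x y : X, x * y = y * x)
    {V : Subgroup X} (hV : Nat.card V = p ^ 2) : Subgroup.center X ≤ V := by
  have hp : p.Prime := Fact.out
  have hVi : V.index = p := Subgroup.index_eq_of_card_eq (n := 2) hX hV
  by_contra hc
  have htop : V ⊔ Subgroup.center X = ⊤ :=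
    Subgroup.eq_top_of_lt_of_index_eq_prime hVi (left_lt_sup.2 hc)
  have hcomm := (IsPGroup.isMulCommutative_of_card_eq_prime_sq hV).is_comm.comm
  exact hne (mul_comm_of_sup_center_eq_top htop hcomm)

/-- The automorphisms acting trivially on the factors of the series `1 < Z(X) < V < X`, except
perhaps the first one. -/
def stabSet (V : Subgroup X) : Set (MulAut X) :=
  {a | (∀ x, x⁻¹ * a x ∈ V) ∧ ∀ v ∈ V, v⁻¹ * a v ∈ Subgroup.center X}

theorem ncard_stabSet_le (hX : Nat.card X = p ^ 3) (hne : ¬ ∀ x y : X, x * y = y * x)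
    {V : Subgroup X} (hV : Nat.card V = p ^ 2) : (stabSet V).ncard ≤ p ^ 3 := by
  have hp : p.Prime := Fact.out
  have hXp : IsPGroup p X := .of_card hX
  have hZ := card_center_of_card_eq_cube hX hne
  have hZV := center_le_of_card_eq_sq hX hne hV
  have hVt : V < ⊤ := lt_top_iff_ne_top.2 fun h => by
    rw [h, Subgroup.card_top, hX] at hV
    exact absurd (Nat.pow_right_injective hp.two_le hV) (by norm_num)
  have hZlt : Subgroup.center X < V := hZV.lt_of_ne fun h => by
    rw [← h, hZ] at hV
    exact absurd (Nat.pow_right_injective hp.two_le ((pow_one p).trans hV)) (by norm_num)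
  obtain ⟨x, -, hx⟩ := SetLike.exists_of_lt hVt
  obtain ⟨v, hv, hvZ⟩ := SetLike.exists_of_lt hZlt
  -- If L contains x and v, then LZ(X) = X. A proper L would have order at most p², hence be
  -- abelian, and X would be abelian as well.
  have htop : ∀ L : Subgroup X, x ∈ L → v ∈ L → L = ⊤ := by
    intro L hxL hvL
    have hVi : V.index = p := Subgroup.index_eq_of_card_eq (n := 2) hX hV
    have h1 : V ≤ L ⊔ Subgroup.center X := by
      have h2 : Subgroup.center X < (L ⊔ Subgroup.center X) ⊓ V :=
        SetLike.lt_iff_le_and_exists.2 ⟨le_inf le_sup_right hZV, v,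
          Subgroup.mem_inf.2 ⟨Subgroup.mem_sup_left hvL, hv⟩, hvZ⟩
      have h3 := Subgroup.card_lt_card_of_lt h2
      rw [hZ] at h3
      rw [← pow_one p] at h3
      have h4 := hXp.pow_succ_le_card h3
      have h5 := Subgroup.eq_of_le_of_card_ge
        (inf_le_right : (L ⊔ Subgroup.center X) ⊓ V ≤ V) (by rw [hV]; exact h4)
      rw [← h5]
      exact inf_le_left
    have h2 : L ⊔ Subgroup.center X = ⊤ := Subgroup.eq_top_of_lt_of_index_eq_prime hVi
      (SetLike.lt_iff_le_and_exists.2 ⟨h1, x, Subgroup.mem_sup_left hxL, hx⟩)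
    by_contra hL
    have hLc : Nat.card L ≤ p ^ 2 := by
      by_contra hc
      exact hL (Subgroup.eq_top_of_le_card L (by
        rw [hX]; exact hXp.pow_succ_le_card (not_le.1 hc)))
    have hLne : ¬ ∀ a b : L, a * b = b * a := by
      intro hcomm
      exact hne (mul_comm_of_sup_center_eq_top h2 hcomm)
    obtain ⟨n, hn⟩ := IsPGroup.iff_card.1 (hXp.to_subgroup L)
    rw [hn, Nat.pow_le_pow_iff_right hp.one_lt] at hLc
    interval_cases n
    · have := (Nat.card_eq_one_iff_unique.1 (hn.trans (pow_zero p))).1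
      exact hLne fun a b => Subsingleton.elim _ _
    · have := isCyclic_of_prime_card (hn.trans (pow_one p))
      exact hLne fun a b => (IsCyclic.commGroup (α := L)).mul_comm a b
    · exact hLne (IsPGroup.isMulCommutative_of_card_eq_prime_sq hn).is_comm.comm
  have hcard : p ^ 3 = Nat.card (V × Subgroup.center X) := by
    rw [Nat.card_prod, hV, hZ]; ring
  rw [hcard, ← Nat.card_coe_set_eq]
  -- As x and v generate X, the automorphism is determined by its two displacements, with p² choices
  -- in V and p in the center.
  refine Nat.card_le_card_of_injective
    (fun a : stabSet V => ((⟨_, a.2.1 x⟩ : V), (⟨_, a.2.2 v hv⟩ : Subgroup.center X))) ?_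
  intro a b hab
  simp only [Prod.mk.injEq, Subtype.mk.injEq, mul_right_inj] at hab
  have htop' := htop (MonoidHom.eqLocus (a : MulAut X).toMonoidHom (b : MulAut X).toMonoidHom)
    hab.1 hab.2
  refine Subtype.ext (MulEquiv.ext fun y => ?_)
  have : y ∈ MonoidHom.eqLocus (a : MulAut X).toMonoidHom (b : MulAut X).toMonoidHom :=
    htop' ▸ Subgroup.mem_top y
  exact this

end SmallGroups

section SmallGroups

variable {p : ℕ} [Fact p.Prime] {X : Type*} [Group X]

theorem MulAut.smul_center_eq (a : MulAut X) : a • Subgroup.center X = Subgroup.center X :=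
  Subgroup.characteristic_iff_map_eq.1 inferInstance a

theorem card_innAut_of_card_eq_cube (hX : Nat.card X = p ^ 3)
    (hne : ¬ ∀ x y : X, x * y = y * x) : Nat.card (innAut X) = p ^ 2 := by
  have hker : (MulAut.conj : X →* MulAut X).ker = Subgroup.center X := by
    ext x
    rw [MonoidHom.mem_ker, Subgroup.mem_center_iff]
    constructor
    · intro h y
      have := DFunLike.congr_fun h y
      rw [MulAut.conj_apply, MulAut.one_apply, mul_inv_eq_iff_eq_mul] at this
      exact this.symm
    · intro h
      ext y
      rw [MulAut.conj_apply, MulAut.one_apply, mul_inv_eq_iff_eq_mul, h]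
  have h1 := (Subgroup.center X).card_mul_index
  rw [card_center_of_card_eq_cube hX hne, hX, ← hker, Subgroup.index_ker] at h1
  exact Nat.eq_of_mul_eq_mul_left (Fact.out : p.Prime).pos (h1.trans (by ring))

variable [Finite X]

theorem IsPGroup.normal_of_index_eq_prime (hX : IsPGroup p X) {V : Subgroup X}
    (hV : V.index = p) : V.Normal := by
  refine Subgroup.normalizer_eq_top_iff.1
    (Subgroup.eq_top_of_lt_of_index_eq_prime hV (hX.lt_normalizer fun h => ?_))
  rw [h, Subgroup.index_top] at hV
  exact (Fact.out : p.Prime).one_lt.ne hV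

/-- The factors X/V and V/Z(X) have order p, so an automorphism of p-power order acts trivially on
both. -/
theorem mem_stabSet_of_pow_eq_one (hX : Nat.card X = p ^ 3) (hne : ¬ ∀ x y : X, x * y = y * x)
    {V : Subgroup X} (hV : Nat.card V = p ^ 2) {a : MulAut X} {k : ℕ} (ha : a ^ p ^ k = 1)
    (haV : a • V = V) : a ∈ stabSet V := by
  have hVi : V.index = p := Subgroup.index_eq_of_card_eq (n := 2) hX hV
  have hVn : V.Normal := (IsPGroup.of_card hX).normal_of_index_eq_prime hVi
  refine ⟨MulAut.inv_mul_apply_mem_of_index_eq_prime hVi ha haV, fun v hv => ?_⟩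
  let b : MulAut V := (a.subgroupMap V).trans (MulEquiv.subgroupCongr haV)
  have hb : ∀ (n : ℕ) (x : V), (((b ^ n) x : V) : X) = (a ^ n) x := by
    intro n
    induction n with
    | zero => intro x; rfl
    | succ n ih =>
      intro x
      rw [pow_succ, pow_succ, MulAut.mul_apply, MulAut.mul_apply, ih]
      rfl
  have hbk : b ^ p ^ k = 1 := by
    ext x
    rw [hb, ha]
    rfl
  have hZV := center_le_of_card_eq_sq hX hne hV
  have hZi : ((Subgroup.center X).subgroupOf V).index = p := by
    refine Subgroup.index_eq_of_card_eq (n := 1) hV ?_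
    rw [Nat.card_congr (Subgroup.subgroupOfEquivOfLe hZV).toEquiv,
      card_center_of_card_eq_cube hX hne, pow_one]
  have hbZ : b • (Subgroup.center X).subgroupOf V = (Subgroup.center X).subgroupOf V := by
    refine Subgroup.eq_of_le_of_card_ge ?_ (Nat.card_congr (Subgroup.equivSMul b _).toEquiv).le
    rintro _ ⟨x, hx, rfl⟩
    have : a • (x : X) ∈ a • Subgroup.center X := Subgroup.smul_mem_pointwise_smul _ _ _ hx
    rw [MulAut.smul_center_eq] at this
    exact this
  exact MulAut.inv_mul_apply_mem_of_index_eq_prime hZi hbk hbZ ⟨v, hv⟩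

/-- U fixes a nontrivial element of X/Z(X); V is the preimage of the subgroup which that element
generates. -/
theorem IsPGroup.exists_invariant_of_card_eq_cube (hX : Nat.card X = p ^ 3)
    (hne : ¬ ∀ x y : X, x * y = y * x) {U : Subgroup (MulAut X)} (hU : IsPGroup p U) :
    ∃ V : Subgroup X, Nat.card V = p ^ 2 ∧ ∀ a ∈ U, a • V = V := by
  have hp : p.Prime := Fact.out
  let ρ : MulAut X →* MulAut (X ⧸ Subgroup.center X) :=
    { toFun := fun a => QuotientGroup.congr _ _ a a.smul_center_eq
      map_one' := by
        ext x
        obtain ⟨x, rfl⟩ := QuotientGroup.mk_surjective x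
        rfl
      map_mul' := fun a b => by
        ext x
        obtain ⟨x, rfl⟩ := QuotientGroup.mk_surjective x
        rfl }
  have hρ : ∀ (a : MulAut X) (x : X), ρ a (x : X ⧸ Subgroup.center X) = (a x : X) :=
    fun a x => rfl
  have hZ := card_center_of_card_eq_cube hX hne
  have hQ : Nat.card (X ⧸ Subgroup.center X) = p ^ 2 := by
    have h1 := (Subgroup.center X).card_mul_index
    rw [hZ, hX] at h1
    exact Nat.eq_of_mul_eq_mul_left hp.pos (by rw [← Subgroup.index, h1]; ring)
  obtain ⟨q, hq1, hq⟩ := (hU.map ρ).exists_fixed_ne_one (X := X ⧸ Subgroup.center X)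
    (hQ ▸ dvd_pow_self p two_ne_zero)
  have hqc : Nat.card (Subgroup.zpowers q) = p := by
    have h1 := (Subgroup.zpowers q).card_subgroup_dvd_card
    rw [hQ, Nat.dvd_prime_pow hp] at h1
    obtain ⟨m, hm, h1⟩ := h1
    interval_cases m
    · rw [pow_zero, Subgroup.card_eq_one, Subgroup.zpowers_eq_bot] at h1
      exact absurd h1 hq1
    · simpa using h1
    · have htop : Subgroup.zpowers q = ⊤ := Subgroup.eq_top_of_card_eq _ (h1.trans hQ.symm)
      have : IsCyclic (X ⧸ Subgroup.center X) :=
        ⟨q, fun x => show x ∈ Subgroup.zpowers q from htop ▸ Subgroup.mem_top x⟩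
      exact absurd (isMulCommutative_of_isCyclic_quotient_center_self X).is_comm.comm hne
  refine ⟨(Subgroup.zpowers q).comap (QuotientGroup.mk' (Subgroup.center X)), ?_, fun a ha => ?_⟩
  · have h1 := ((Subgroup.zpowers q).comap (QuotientGroup.mk' (Subgroup.center X))).card_mul_index
    rw [Subgroup.index_comap_of_surjective _ (QuotientGroup.mk'_surjective _),
      Subgroup.index_eq_of_card_eq (n := 1) hQ (hqc.trans (pow_one p).symm), hX] at h1
    exact Nat.eq_of_mul_eq_mul_right hp.pos (h1.trans (by ring))
  · refine Subgroup.eq_of_le_of_card_ge ?_ (Nat.card_congr (Subgroup.equivSMul a _).toEquiv).le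
    rintro _ ⟨x, hx, rfl⟩
    obtain ⟨n, hn⟩ := hx
    refine ⟨n, ?_⟩
    change q ^ n = ((a x : X) : X ⧸ Subgroup.center X)
    change q ^ n = (x : X ⧸ Subgroup.center X) at hn
    rw [← hρ, ← hn, map_zpow, hq _ ⟨a, ha, rfl⟩]

/-- A `p`-group of automorphisms of a non-abelian group of order `p ^ 3` has order at most
`p ^ 3`. -/
theorem IsPGroup.card_le_of_card_eq_cube (hX : Nat.card X = p ^ 3)
    (hne : ¬ ∀ x y : X, x * y = y * x) {U : Subgroup (MulAut X)} (hU : IsPGroup p U) :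
    Nat.card U ≤ p ^ 3 := by
  obtain ⟨V, hV, hUV⟩ := hU.exists_invariant_of_card_eq_cube hX hne
  refine le_trans ?_ (ncard_stabSet_le hX hne hV)
  refine Set.ncard_le_ncard (s := (U : Set (MulAut X))) (fun a ha => ?_) (Set.toFinite _)
  obtain ⟨k, hk⟩ := hU ⟨a, ha⟩
  exact mem_stabSet_of_pow_eq_one hX hne hV (congrArg Subtype.val hk) (hUV a ha)

/-- All these subgroups contain the center and any two meet exactly in it. Their p² - p noncentral
elements are therefore disjoint subsets of the p³ - p noncentral elements of X. -/
theorem ncard_subgroups_of_card_eq_cube (hX : Nat.card X = p ^ 3)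
    (hne : ¬ ∀ x y : X, x * y = y * x) : {V : Subgroup X | Nat.card V = p ^ 2}.ncard ≤ p + 1 := by
  classical
  have hp : p.Prime := Fact.out
  have hXp : IsPGroup p X := .of_card hX
  have hZ := card_center_of_card_eq_cube hX hne
  have := Fintype.ofFinite X
  have := Fintype.ofFinite (Subgroup X)
  let Ω : Finset (Subgroup X) := {V | Nat.card V = p ^ 2}
  have hΩ : {V : Subgroup X | Nat.card V = p ^ 2}.ncard = Ω.card := by
    rw [← Set.ncard_coe_finset]
    congr 1
    ext V
    simp [Ω]
  rw [hΩ]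
  let Zf : Finset X := {x | x ∈ Subgroup.center X}
  let f : Subgroup X → Finset X := fun V => ({x | x ∈ V} : Finset X) \ Zf
  have hcardf : ∀ V : Subgroup X, (({x | x ∈ V} : Finset X)).card = Nat.card V := by
    intro V
    rw [Nat.card_eq_fintype_card, Fintype.card_subtype]
  have hZf : Zf.card = p := by
    rw [← hZ, ← hcardf]
    congr 1
    ext x
    simp [Zf]
  have hf : ∀ V ∈ Ω, (f V).card + p = p ^ 2 := by
    intro V hV
    have hV' : Nat.card V = p ^ 2 := by simpa [Ω] using hV
    have hsub : Zf ⊆ ({x | x ∈ V} : Finset X) := by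
      intro x hx
      have hx' : x ∈ Subgroup.center X := by simpa [Zf] using hx
      simpa using center_le_of_card_eq_sq hX hne hV' hx'
    have h1 := Finset.card_sdiff_add_card_eq_card hsub
    rw [hcardf, hZf, hV'] at h1
    exact h1
  have hdisj : (Ω : Set (Subgroup X)).PairwiseDisjoint f := by
    intro V hV W hW hVW
    have hV' : Nat.card V = p ^ 2 := by simpa [Ω] using hV
    have hW' : Nat.card W = p ^ 2 := by simpa [Ω] using hW
    refine Finset.disjoint_left.2 fun x hxV hxW => hVW ?_
    simp only [f, Zf, Finset.mem_sdiff, Finset.mem_filter, Finset.mem_univ, true_and] at hxV hxW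
    have hlt : Subgroup.center X < V ⊓ W := SetLike.lt_iff_le_and_exists.2
      ⟨le_inf (center_le_of_card_eq_sq hX hne hV') (center_le_of_card_eq_sq hX hne hW'), x,
        Subgroup.mem_inf.2 ⟨hxV.1, hxW.1⟩, hxV.2⟩
    have h3 := Subgroup.card_lt_card_of_lt hlt
    rw [hZ, ← pow_one p] at h3
    have h4 := hXp.pow_succ_le_card h3
    have h5 := Subgroup.eq_of_le_of_card_ge (inf_le_left : V ⊓ W ≤ V) (by rw [hV']; exact h4)
    have h6 := Subgroup.eq_of_le_of_card_ge (inf_le_right : V ⊓ W ≤ W) (by rw [hW']; exact h4)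
    rw [← h5, h6]
  have hle : (Ω.biUnion f).card + p ≤ p ^ 3 := by
    have h1 : Ω.biUnion f ⊆ Finset.univ \ Zf := by
      intro x hx
      obtain ⟨V, -, hxV⟩ := Finset.mem_biUnion.1 hx
      exact Finset.sdiff_subset_sdiff (Finset.subset_univ _) le_rfl hxV
    have h2 := Finset.card_le_card h1
    have h3 := Finset.card_sdiff_add_card_eq_card (Finset.subset_univ Zf)
    rw [hZf, Finset.card_univ, ← Nat.card_eq_fintype_card, hX] at h3
    omega
  rw [Finset.card_biUnion hdisj] at hle
  have hsum : ∑ V ∈ Ω, (f V).card = Ω.card * (p ^ 2 - p) := by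
    rw [Finset.sum_const_nat]
    intro V hV
    have := hf V hV
    omega
  rw [hsum] at hle
  by_contra hc
  have hc' : p + 2 ≤ Ω.card := by omega
  have h2 := hp.two_le
  obtain ⟨d, hd⟩ : ∃ d, p ^ 2 = p + d := 
    ⟨p ^ 2 - p, by have : p ≤ p ^ 2 := by nlinarith
                   omega⟩
  have hdd : p ^ 2 - p = d := by omega
  rw [hdd] at hle
  have h3 : (p + 2) * d ≤ Ω.card * d := Nat.mul_le_mul_right d hc'
  have hd' : d = p * p - p := by rw [← hdd, pow_two]
  have hp3 : p ^ 3 = p * p + p * d := by rw [pow_succ' p 2, hd]; ring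
  nlinarith

/-- If A fixed V, every p-subgroup of A would lie in `stabSet V`, which has at most p³ elements. The
preimage T of a subgroup of order p of H has exactly p³, so T fills that set and is normal in A.
Then H contains a subgroup of order p normal in the quotient, against strong embedding. -/
theorem not_invariant_of_isStronglyEmbedded (hX : Nat.card X = p ^ 3)
    (hne : ¬ ∀ x y : X, x * y = y * x) {A : Subgroup (MulAut X)} (hA : innAut X ≤ A)
    {H : Subgroup (A ⧸ (innAut X).subgroupOf A)} (hH : IsStronglyEmbedded p H)
    {V : Subgroup X} (hV : Nat.card V = p ^ 2) : ¬ ∀ a ∈ A, a • V = V := by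
  intro hAV
  obtain ⟨hHt, hHp, hHg⟩ := hH
  set I := (innAut X).subgroupOf A with hI
  obtain ⟨⟨x, hxH⟩, hx⟩ := exists_prime_orderOf_dvd_card' p hHp
  rw [← Subgroup.orderOf_coe] at hx
  change orderOf x = p at hx
  let T : Subgroup A := (Subgroup.zpowers x).comap (QuotientGroup.mk' I)
  have hT : Nat.card T = p ^ 3 := by
    have h1 := T.card_mul_index
    have h2 := I.card_mul_index
    have h3 := (Subgroup.zpowers x).card_mul_index
    have h4 : T.index = (Subgroup.zpowers x).index :=
      Subgroup.index_comap_of_surjective _ (QuotientGroup.mk'_surjective _)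
    have h5 : Nat.card I = p ^ 2 := by
      rw [Nat.card_congr (Subgroup.subgroupOfEquivOfLe hA).toEquiv,
        card_innAut_of_card_eq_cube hX hne]
    rw [Nat.card_zpowers, hx, ← Subgroup.index, ← h4] at h3
    rw [← h2, ← h3, h5] at h1
    have h6 : 0 < T.index := Nat.pos_of_ne_zero Subgroup.index_ne_zero_of_finite
    exact Nat.eq_of_mul_eq_mul_right h6 (by rw [h1]; ring)
  have hTK : ∀ (g : A) (t : A), t ∈ T → ((g * t * g⁻¹ : A) : MulAut X) ∈ stabSet V := by
    intro g t ht
    obtain ⟨k, hk⟩ := (IsPGroup.of_card hT) ⟨t, ht⟩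
    refine mem_stabSet_of_pow_eq_one (k := k) hX hne hV ?_ (hAV _ (g * t * g⁻¹).2)
    have hk' : t ^ p ^ k = 1 := congrArg Subtype.val hk
    rw [← Subgroup.coe_pow, conj_pow, hk']
    simp
  have himg : (Subtype.val '' (T : Set A) : Set (MulAut X)) = stabSet V := by
    refine Set.eq_of_subset_of_ncard_le ?_ ?_ (Set.toFinite _)
    · rintro _ ⟨t, ht, rfl⟩
      simpa using hTK 1 t ht
    · rw [Set.ncard_image_of_injective _ Subtype.val_injective]
      exact (ncard_stabSet_le hX hne hV).trans hT.ge
  obtain ⟨gb, -, hgb⟩ := SetLike.exists_of_lt (lt_top_iff_ne_top.2 hHt)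
  obtain ⟨g, rfl⟩ := QuotientGroup.mk'_surjective I gb
  obtain ⟨t, rfl⟩ := QuotientGroup.mk'_surjective I x
  have hgt : g * t * g⁻¹ ∈ T := by
    have := hTK g t (Subgroup.mem_zpowers (QuotientGroup.mk' I t))
    rw [← himg] at this
    obtain ⟨s, hs, hst⟩ := this
    rwa [← Subtype.ext hst]
  refine hHg _ hgb ?_
  let y : (H ⊓ H.map (MulAut.conj (QuotientGroup.mk' I g)).toMonoidHom :
      Subgroup (A ⧸ I)) := ⟨QuotientGroup.mk' I (g * t * g⁻¹), by
    refine Subgroup.mem_inf.2 ⟨(Subgroup.zpowers_le.2 hxH) hgt, ?_⟩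
    exact ⟨QuotientGroup.mk' I t, hxH, by simp⟩⟩
  have hy : orderOf y = p := by
    rw [← Subgroup.orderOf_coe, ← hx]
    change orderOf (QuotientGroup.mk' I (g * t * g⁻¹)) = _
    have : QuotientGroup.mk' I (g * t * g⁻¹) =
        MulAut.conj (QuotientGroup.mk' I g) (QuotientGroup.mk' I t) := by simp
    rw [this]
    exact MulEquiv.orderOf_eq (MulAut.conj (QuotientGroup.mk' I g)) _
  exact hy ▸ orderOf_dvd_natCard y

/-- A group of automorphisms of a non-abelian group of order `p ^ 3` that is strongly `p`-embedded
modulo the inner automorphisms moves each subgroup of order `p ^ 2` to one invariant under a given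
`p`-subgroup. -/
theorem exists_smul_invariant (hX : Nat.card X = p ^ 3)
    (hne : ¬ ∀ x y : X, x * y = y * x) {A : Subgroup (MulAut X)} (hA : innAut X ≤ A)
    {H : Subgroup (A ⧸ (innAut X).subgroupOf A)} (hH : IsStronglyEmbedded p H)
    {U : Subgroup (MulAut X)} (hU : IsPGroup p U) (hUA : U ≤ A)
    {R : Subgroup X} (hR : Nat.card R = p ^ 2) :
    ∃ b ∈ A, ∀ u ∈ U, u • b • R = b • R := by
  have hp : p.Prime := Fact.out
  by_contra! hc
  obtain ⟨V, hV, hUV⟩ := hU.exists_invariant_of_card_eq_cube hX hne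
  obtain ⟨a, ha, haV⟩ : ∃ a ∈ A, a • V ≠ V := by
    have := not_invariant_of_isStronglyEmbedded hX hne hA hH hV
    push Not at this
    exact this
  have hcardsmul : ∀ (b : MulAut X) (W : Subgroup X), Nat.card (b • W : Subgroup X) = Nat.card W :=
    fun b W => (Nat.card_congr (Subgroup.equivSMul b W).toEquiv).symm
  have hRV : ∀ b ∈ A, b • R ≠ V := by
    intro b hb hbR
    obtain ⟨u, hu, hub⟩ := hc b hb
    exact hub (by rw [hbR, hUV u hu])
  -- The orbit length is a power of p, and is not 1 since R itself is not U-invariant.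
  have horb : p ≤ (MulAction.orbit U R).ncard := by
    obtain ⟨n, hn⟩ := hU.card_orbit R
    rw [← Nat.card_coe_set_eq, hn]
    refine Nat.le_self_pow ?_ p
    rintro rfl
    obtain ⟨u, hu, hub⟩ := hc 1 A.one_mem
    rw [one_smul] at hub
    have := (Nat.card_eq_one_iff_unique.1 (hn.trans (pow_zero p))).1
    have h2 : (⟨_, MulAction.mem_orbit R (⟨u, hu⟩ : U)⟩ : MulAction.orbit U R) =
      ⟨R, MulAction.mem_orbit_self R⟩ := Subsingleton.elim _ _
    exact hub (congrArg Subtype.val h2)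
  have hV1 : V ∉ MulAction.orbit U R := by
    rintro ⟨u, hu⟩
    exact hRV u (hUA u.2) hu
  -- The at least p members of the U-orbit of R, together with V and a(V), are p + 2 different
  -- subgroups of order p², one too many.
  have hV2 : a • V ∉ insert V (MulAction.orbit U R) := by
    rintro (h | ⟨u, hu⟩)
    · exact haV h
    · refine hRV (a⁻¹ * u) (A.mul_mem (A.inv_mem ha) (hUA u.2)) ?_
      rw [mul_smul, inv_smul_eq_iff]
      exact hu
  have h1 : (insert (a • V) (insert V (MulAction.orbit U R))).ncard =
      (MulAction.orbit U R).ncard + 1 + 1 := by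
    rw [Set.ncard_insert_of_notMem hV2 (Set.toFinite _),
      Set.ncard_insert_of_notMem hV1 (Set.toFinite _)]
  have h2 : insert (a • V) (insert V (MulAction.orbit U R)) ⊆
      {V : Subgroup X | Nat.card V = p ^ 2} := by
    rintro W (rfl | rfl | ⟨u, rfl⟩)
    · exact (hcardsmul a V).trans hV
    · exact hV
    · exact (hcardsmul u R).trans hR
  have h3 := Set.ncard_le_ncard h2 (Set.toFinite _)
  have h4 := ncard_subgroups_of_card_eq_cube hX hne
  omega

end SmallGroups

/-! ### The conjugacy class of P; pearls of order p² -/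

namespace FusionSystem

variable {S : Type*} [Group S] {F : FusionSystem S}

theorem card_normalizer_eq (A : Subgroup S) : Nat.card (Subgroup.normalizer (A : Set S)) =
    Nat.card (Subgroup.centralizer (A : Set S)) * Nat.card (autS A) := by
  rw [← (Subgroup.normalizerMonoidHom A).ker.card_mul_index, Subgroup.index_ker,
    Subgroup.normalizerMonoidHom_ker,
    Nat.card_congr (Subgroup.subgroupOfEquivOfLe (Subgroup.centralizer_le_normalizer _)).toEquiv]
  rfl

theorem center_le_centralizer (A : Subgroup S) :
    Subgroup.center S ≤ Subgroup.centralizer (A : Set S) :=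
  Subgroup.center_le_centralizer _

theorem centralizer_anti {A B : Subgroup S} (h : A ≤ B) :
    Subgroup.centralizer (B : Set S) ≤ Subgroup.centralizer (A : Set S) :=
  Subgroup.centralizer_le h

theorem centralizer_le_centralizer_sup_center (R : Subgroup S) :
    Subgroup.centralizer (R : Set S) ≤
      Subgroup.centralizer ((R ⊔ Subgroup.center S : Subgroup S) : Set S) := by
  intro x hx
  have h : R ⊔ Subgroup.center S ≤ Subgroup.centralizer {x} := by
    refine sup_le (fun y hy => ?_) (Subgroup.center_le_centralizer _)
    exact Subgroup.mem_centralizer_singleton_iff.2 (Subgroup.mem_centralizer_iff.1 hx y hy)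
  exact Subgroup.mem_centralizer_iff.2 fun y hy => Subgroup.mem_centralizer_singleton_iff.1 (h hy)

/-- `A` is `F`-conjugate to `P`. -/
def Cls (F : FusionSystem S) (P A : Subgroup S) : Prop :=
  F.SubConj A P ∧ Nat.card A = Nat.card P

protected theorem Cls.img {P A : Subgroup S} {f : S → S} (h : F.Cls P A) (hf : F.Mor f A) : F.Cls P (img f A) :=
  ⟨h.1.img hf, by rw [hf.card_img, h.2]⟩

theorem cls_self (F : FusionSystem S) (P : Subgroup S) : F.Cls P P :=
  ⟨⟨id, mor_id F P, (img_id P).le⟩, rfl⟩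

section Finite

variable [Finite S] {p : ℕ} {P A : Subgroup S}

theorem Cls.exists_mor (h : F.Cls P A) : ∃ f, F.Mor f A ∧ img f A = P := by
  obtain ⟨⟨f, hf, hfP⟩, hc⟩ := h
  exact ⟨f, hf, Subgroup.eq_of_le_of_card_ge hfP (by rw [hf.card_img, hc])⟩

theorem Cls.isConj (h : F.Cls P A) : F.IsConj P A := by
  obtain ⟨f, hf, rfl⟩ := h.exists_mor
  obtain ⟨g, hg, -, hgA⟩ := hf.inv
  exact isConj_iff.2 ⟨g, hg, hgA⟩

theorem Cls.centralizer_le (hP : F.IsEssential p P) (h : F.Cls P A) :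
    Subgroup.centralizer (A : Set S) ≤ A :=
  isSCentric_iff.1 (hP.2.1 A h.isConj)

theorem Cls.not_comm (hP : ¬ ∀ x y : P, x * y = y * x) (h : F.Cls P A) :
    ¬ ∀ x y : A, x * y = y * x := by
  intro hc
  obtain ⟨f, hf, hfP⟩ := h.exists_mor
  obtain ⟨e, -, -⟩ := hf.equiv hfP
  exact hP fun x y => e.symm.injective (by rw [map_mul, map_mul, hc])

theorem card_lt_of_isEssential (hP : F.IsEssential p P) : Nat.card P < Nat.card S := by
  have := Subgroup.card_lt_card_of_lt hP.1
  rwa [Subgroup.card_top] at this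

theorem center_le_of_mem {C : Set (Subgroup S)} (hC : F.IsEssentialReps p C) {E : Subgroup S}
    (hE : E ∈ insert ⊤ (C \ {P})) : Subgroup.center S ≤ E := by
  rcases hE with rfl | ⟨hEC, -⟩
  · exact le_top
  · exact (center_le_centralizer E).trans ((cls_self F E).centralizer_le (hC.1 E hEC))

theorem not_cls_of_mem {C : Set (Subgroup S)} (hC : F.IsEssentialReps p C) (hPC : P ∈ C) {E : Subgroup S}
    (hE : E ∈ insert ⊤ (C \ {P})) : ¬ F.Cls P E := by
  intro h
  rcases hE with rfl | ⟨hEC, hEP⟩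
  · have h1 := card_lt_of_isEssential (hC.1 P hPC)
    rw [← h.2, Subgroup.card_top] at h1
    exact h1.false
  · obtain ⟨R, -, hR⟩ := hC.2 E (hC.1 E hEC)
    obtain ⟨f, hf, hfP⟩ := h.exists_mor
    have h1 := hR E ⟨hEC, isConj_iff.2 ⟨id, mor_id F E, img_id E⟩⟩
    have h2 := hR P ⟨hPC, isConj_iff.2 ⟨f, hf, hfP⟩⟩
    exact hEP (h1.trans h2.symm)

variable [Fact p.Prime]

theorem normalizer_le_centralizer (hS : IsPGroup p S) {R : Subgroup S} (hR : Nat.card R ∣ p) :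
    Subgroup.normalizer (R : Set S) ≤ Subgroup.centralizer (R : Set S) := by
  have h1 := (isPGroup_autS hS R).card_le_one_of_card_dvd_prime hR
  have h2 := card_normalizer_eq R
  refine (Subgroup.eq_of_le_of_card_ge (Subgroup.centralizer_le_normalizer _) ?_).ge
  rw [h2]
  exact (Nat.mul_le_mul_left _ h1).trans (mul_one _).le

theorem Cls.lt_normalizer (hS : IsPGroup p S) (hP : F.IsEssential p P) (h : F.Cls P A) :
    A < Subgroup.normalizer (A : Set S) := by
  refine hS.lt_normalizer ?_
  rintro rfl
  have h1 := card_lt_of_isEssential hP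
  rw [← h.2, Subgroup.card_top] at h1
  exact h1.false

theorem not_subConj_of_card_lt (h : Nat.card P < Nat.card A) : ¬ F.SubConj A P :=
  fun hA => hA.card_le.not_gt h

section Reps

variable {C : Set (Subgroup S)}

/-- The criterion applies with Y empty and χ the identity: the normalizer of a conjugate of P is too
large to be conjugate into P, and an extension domain that is conjugate into P cannot exceed the
subgroup itself. -/
theorem exists_isReceptive_of_not_subConj_or_cls (hS : IsPGroup p S) (hF : F.IsSaturated p)
    (hC : F.IsEssentialReps p C) (hPC : P ∈ C)
    {G : FusionSystem S} (hG : G = generate (F.automizers (insert ⊤ (C \ {P}))))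
    {Q : Subgroup S} (hQ : ¬ F.SubConj Q P ∨ F.Cls P Q) :
    ∃ R, G.IsConj Q R ∧ G.IsFullyAutomized p R ∧ G.IsReceptive R := by
  refine exists_isReceptive_generate hS hF hC P hG (K := {R | ¬ F.SubConj R P ∨ F.Cls P R})
    (Y := ∅) ?_ (by simp) ?_ (by simp) hQ
  · rintro R (hR | hR) f hf
    · exact .inl fun h => hR (.of_mor hf h)
    · exact .inr (hR.img hf)
  · intro R hR _
    refine ⟨id, mor_id _ _, ?_, ?_⟩
    · rw [img_id]
      rcases hR with hR | hR
      · exact fun h => hR (h.mono Subgroup.le_normalizer)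
      · refine not_subConj_of_card_lt ?_
        rw [← hR.2]
        exact Subgroup.card_lt_card_of_lt (hR.lt_normalizer hS (hC.1 P hPC))
    · rw [img_id]
      intro f hf N hN hNP
      have hRN : R ≤ N := fun x hx => (hN x).2 (hf.ctrl_of_mem hx)
      rcases hR with hR | hR
      · exact absurd (hNP.mono hRN) hR
      · exact (Subgroup.eq_of_le_of_card_ge hRN (hR.2 ▸ hNP.card_le)).symm

/-- The saturation axiom of the subsystem for subgroups of order `1` and `p`. -/
theorem exists_isReceptive_of_card_dvd_prime (hS : IsPGroup p S) (hF : F.IsSaturated p)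
    (hC : F.IsEssentialReps p C) (hPC : P ∈ C) (hZ : Nat.card (Subgroup.center S) = p)
    {G : FusionSystem S} (hG : G = generate (F.automizers (insert ⊤ (C \ {P}))))
    {Y : Set (Subgroup S)}
    (hY : ∀ W ∈ Y, Nat.card W = p ^ 2 ∧ Subgroup.centralizer (W : Set S) ≤ W)
    (hYD : ∀ W ∈ Y, ∀ E ∈ insert ⊤ (C \ {P}), W ≤ E →
      W ≠ E ∧ ∀ a, F.Mor a E → img a E = E → img a W ∈ Y)
    (hYc : ∀ R : Subgroup S, Nat.card R = p → R ≠ Subgroup.center S → R ⊔ Subgroup.center S ∉ Y →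
      ∃ χ, G.Mor χ (Subgroup.normalizer (R : Set S)) ∧
        ¬ F.SubConj (Subgroup.normalizer (img χ R : Set S)) P)
    {Q : Subgroup S} (hQ : Nat.card Q ∣ p) :
    ∃ R, G.IsConj Q R ∧ G.IsFullyAutomized p R ∧ G.IsReceptive R := by
  have hp : p.Prime := Fact.out
  refine exists_isReceptive_generate hS hF hC P hG (K := {R | Nat.card R ∣ p})
    (Y := {R | Nat.card R = p ∧ R ≠ Subgroup.center S ∧ R ⊔ Subgroup.center S ∈ Y}) ?_ ?_ ?_ ?_ hQ
  · intro R hR f hf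
    change Nat.card _ ∣ p
    rwa [hf.card_img]
  · rintro R ⟨hRp, hRZ, hRY⟩ E hE hRE
    have hZE : Subgroup.center S ≤ E := center_le_of_mem hC hE
    obtain ⟨hWc, hWcent⟩ := hY _ hRY
    set W := R ⊔ Subgroup.center S with hW
    have hWE : W ≤ E := sup_le hRE hZE
    obtain ⟨hWne, hWimg⟩ := hYD W hRY E hE hWE
    -- The centralizer of E lies between Z(S) and W, of orders p and p². Were it W, then E would
    -- centralize W and so lie in W. Hence automorphisms of E preserve Z(S).
    have hcE : Subgroup.centralizer (E : Set S) = Subgroup.center S := by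
      have h1 : Subgroup.centralizer (E : Set S) ≤ W := (centralizer_anti hWE).trans hWcent
      refine (Subgroup.eq_of_le_of_card_ge (center_le_centralizer E) ?_).symm
      rw [hZ]
      by_contra hc
      have h2 := hS.pow_succ_le_card (k := 1) (by rwa [pow_one, ← not_le])
      have h3 := Subgroup.eq_of_le_of_card_ge h1 (by rw [hWc]; exact h2)
      refine hWne (le_antisymm hWE (le_trans ?_ hWcent))
      rw [← Subgroup.le_centralizer_iff, h3]
    refine ⟨(normalizer_le_centralizer hS hRp.dvd).trans
      ((centralizer_le_centralizer_sup_center R).trans (hWcent.trans hWE)), fun a ha haE => ?_⟩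
    have haZ : img a (Subgroup.center S) = Subgroup.center S := by
      refine Subgroup.eq_of_le_of_card_ge ?_ ?_
      · rw [img_le_iff]
        intro x hx
        have := ha.centralizer_mem le_rfl (hZE hx) (center_le_centralizer E hx)
        rwa [haE, hcE] at this
      · rw [(ha.restrict hZE).card_img]
    have haR : img a R ≠ Subgroup.center S := by
      intro h
      refine hRZ (Subgroup.eq_of_le_of_card_ge (fun x hx => ?_) (by rw [hRp, hZ]))
      rw [← ha.mem_img_iff hZE (hRE hx), haZ, ← h]
      exact apply_mem_img a hx
    have haRc : Nat.card (img a R) = p := by rw [(ha.restrict hRE).card_img, hRp]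
    refine ⟨haRc, haR, ?_⟩
    have hsup : img a R ⊔ Subgroup.center S = img a W := by
      refine Subgroup.eq_of_le_of_card_ge (sup_le (img_mono a le_sup_left) ?_) ?_
      · rw [← haZ]
        exact img_mono a le_sup_right
      · rw [(ha.restrict hWE).card_img, hWc]
        refine hS.pow_succ_le_card (k := 1) ?_
        have hlt : img a R < img a R ⊔ Subgroup.center S := left_lt_sup.2 fun h =>
          haR (Subgroup.eq_of_le_of_card_ge h (by rw [haRc, hZ])).symm
        have := Subgroup.card_lt_card_of_lt hlt
        rwa [haRc, ← pow_one p] at this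
    rw [hsup]
    exact hWimg a ha haE
  · intro R hR hRY
    have hmain : ∃ χ, G.Mor χ (Subgroup.normalizer (R : Set S)) ∧
        ¬ F.SubConj (Subgroup.normalizer (img χ R : Set S)) P := by
      have htop : ∀ R : Subgroup S, R ≤ Subgroup.center S →
          ¬ F.SubConj (Subgroup.normalizer (R : Set S)) P := by
        intro R hR
        refine not_subConj_of_card_lt ?_
        have : Subgroup.centralizer (R : Set S) = ⊤ := Subgroup.centralizer_eq_top_iff_subset.2 hR
        rw [top_le_iff.1 (this.symm.trans_le (Subgroup.centralizer_le_normalizer _)),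
          Subgroup.card_top]
        exact card_lt_of_isEssential (hC.1 P hPC)
      rcases (Nat.dvd_prime hp).1 hR with hR1 | hRp
      · refine ⟨id, mor_id _ _, ?_⟩
        rw [img_id]
        refine htop R ?_
        rw [Subgroup.card_eq_one.1 hR1]
        exact bot_le
      · by_cases hRZ : R = Subgroup.center S
        · refine ⟨id, mor_id _ _, ?_⟩
          rw [img_id]
          exact htop R hRZ.le
        · exact hYc R hRp hRZ fun h => hRY ⟨hRp, hRZ, h⟩
    obtain ⟨χ, hχ, hχn⟩ := hmain
    -- An extension domain always contains the centralizer, which for order 1 or p is the whole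
    -- normalizer; so it is not conjugate into P.
    refine ⟨χ, hχ, hχn, fun f hf N hN hNP => absurd (hNP.mono ?_) hχn⟩
    have hc : Nat.card (img χ R) ∣ p := by
      rw [(hχ.restrict Subgroup.le_normalizer).card_img]
      exact hR
    intro x hx
    exact (hN x).2 (ctrl_of_mem_centralizer (normalizer_le_centralizer hS hc hx))
  · rintro R hR -
    refine isFullyAutomized_of_card_le hS fun U hU => ?_
    exact (hU.card_le_one_of_card_dvd_prime hR).trans (Nat.one_le_iff_ne_zero.2 Nat.card_pos.ne')

theorem exists_isReceptive_of_card_eq_sq (hS : IsPGroup p S) (hF : F.IsSaturated p)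
    (hC : F.IsEssentialReps p C) (hPC : P ∈ C) (hP : Nat.card P = p ^ 2)
    {G : FusionSystem S} (hG : G = generate (F.automizers (insert ⊤ (C \ {P}))))
    (Q : Subgroup S) :
    ∃ R, G.IsConj Q R ∧ G.IsFullyAutomized p R ∧ G.IsReceptive R := by
  have hp : p.Prime := Fact.out
  have hess := hC.1 P hPC
  by_cases hQ : ¬ F.SubConj Q P ∨ F.Cls P Q
  · exact exists_isReceptive_of_not_subConj_or_cls hS hF hC hPC hG hQ
  push Not at hQ
  have hQp : Nat.card Q ∣ p := by
    obtain ⟨n, hn⟩ := IsPGroup.iff_card.1 (hS.to_subgroup Q)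
    have h1 := hQ.1.card_le.lt_of_ne fun h => hQ.2 ⟨hQ.1, h⟩
    rw [hn, hP, Nat.pow_lt_pow_iff_right hp.one_lt] at h1
    rw [hn]
    exact (Nat.pow_dvd_pow p (Nat.le_of_lt_succ h1)).trans (pow_one p).dvd
  have hcP := (cls_self F P).centralizer_le hess
  have hPS := card_lt_of_isEssential hess
  have hZ : Nat.card (Subgroup.center S) = p := by
    have hZP : Subgroup.center S ≤ P := (center_le_centralizer P).trans hcP
    obtain ⟨n, hn⟩ := IsPGroup.iff_card.1 (hS.to_subgroup (Subgroup.center S))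
    have hZ1 := Subgroup.card_le_of_le hZP
    rw [hn, hP, Nat.pow_le_pow_iff_right hp.one_lt] at hZ1
    have : Nontrivial S := Finite.one_lt_card_iff_nontrivial.1
      ((Nat.one_le_iff_ne_zero.2 Nat.card_pos.ne').trans_lt hPS)
    interval_cases n
    · have := hS.center_nontrivial
      rw [pow_zero] at hn
      exact absurd hn (Finite.one_lt_card_iff_nontrivial.2 this).ne'
    · simpa using hn
    · have h1 := Subgroup.eq_of_le_of_card_ge hZP (by rw [hn, hP])
      have h2 : Subgroup.centralizer (P : Set S) = ⊤ :=
        Subgroup.centralizer_eq_top_iff_subset.2 h1.ge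
      rw [h2, top_le_iff] at hcP
      exact absurd hcP hess.1.ne
  refine exists_isReceptive_of_card_dvd_prime hS hF hC hPC hZ hG (Y := {W | F.Cls P W}) ?_ ?_ ?_ hQp
  · exact fun W hW => ⟨hW.2.trans hP, hW.centralizer_le hess⟩
  · intro W hW E hE hWE
    refine ⟨?_, fun a ha _ => hW.img (ha.restrict hWE)⟩
    rintro rfl
    exact not_cls_of_mem hC hPC hE hW
  · intro R hR hRZ hRY
    refine ⟨id, mor_id _ _, ?_⟩
    rw [img_id]
    -- N_S(R) contains RZ(S), of order at least p² = |P|. If it were conjugate into P, then RZ(S)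
    -- would be conjugate to P, so R would fall under the case excluded by `hRY`.
    intro hN
    have hW := hN.mono (A := R ⊔ Subgroup.center S) (sup_le Subgroup.le_normalizer
      ((center_le_centralizer R).trans (Subgroup.centralizer_le_normalizer _)))
    refine hRY ⟨hW, le_antisymm hW.card_le ?_⟩
    rw [hP]
    refine hS.pow_succ_le_card (k := 1) ?_
    have hlt : R < R ⊔ Subgroup.center S := left_lt_sup.2 fun h =>
      hRZ (Subgroup.eq_of_le_of_card_ge h (by rw [hR, hZ])).symm
    have := Subgroup.card_lt_card_of_lt hlt
    rwa [hR, ← pow_one p] at this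

end Reps

end Finite

end FusionSystem

/-! ### Non-abelian pearls of order p³ -/

namespace FusionSystem

variable {S : Type*} [Group S] {F : FusionSystem S} [Finite S] {p : ℕ} [Fact p.Prime]
  {P A : Subgroup S}

theorem card_le_of_central (hA : Nat.card A = p ^ 3) (hne : ¬ ∀ x y : A, x * y = y * x)
    {W : Subgroup S} (hWA : W ≤ A) (hW : ∀ w ∈ W, ∀ x ∈ A, x * w = w * x) : Nat.card W ≤ p := by
  have h1 : W.subgroupOf A ≤ Subgroup.center A := fun w hw =>
    Subgroup.mem_center_iff.2 fun x => Subtype.ext (hW w hw x x.2)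
  have h2 := Subgroup.card_le_of_le h1
  rwa [card_center_of_card_eq_cube hA hne,
    Nat.card_congr (Subgroup.subgroupOfEquivOfLe hWA).toEquiv] at h2

/-- W is abelian of index p in A. If its centralizer in A were larger than W it would be A, putting
p² elements into a center of order p. -/
theorem mem_of_mem_centralizer (hS : IsPGroup p S) (hA : Nat.card A = p ^ 3)
    (hne : ¬ ∀ x y : A, x * y = y * x) {W : Subgroup S} (hWA : W ≤ A) (hW : Nat.card W = p ^ 2)
    {x : S} (hxA : x ∈ A) (hx : x ∈ Subgroup.centralizer (W : Set S)) : x ∈ W := by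
  have hp : p.Prime := Fact.out
  by_contra hxW
  have hcomm := (IsPGroup.isMulCommutative_of_card_eq_prime_sq hW).is_comm.comm
  have hlt : W < Subgroup.centralizer (W : Set S) ⊓ A := by
    refine SetLike.lt_iff_le_and_exists.2 ⟨le_inf (fun w hw => ?_) hWA, x,
      Subgroup.mem_inf.2 ⟨hx, hxA⟩, hxW⟩
    exact Subgroup.mem_centralizer_iff.2 fun v hv =>
      congrArg Subtype.val (hcomm ⟨v, hv⟩ ⟨w, hw⟩)
  have h1 := Subgroup.card_lt_card_of_lt hlt
  rw [hW] at h1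
  have h2 := Subgroup.eq_of_le_of_card_ge
    (inf_le_right : Subgroup.centralizer (W : Set S) ⊓ A ≤ A) (by
      rw [hA]; exact hS.pow_succ_le_card h1)
  have h3 := card_le_of_central hA hne hWA fun w hw y hy => by
    rw [← h2] at hy
    exact (Subgroup.mem_centralizer_iff.1 (Subgroup.mem_inf.1 hy).1 w hw).symm
  rw [hW] at h3
  have := hp.two_le
  nlinarith

theorem card_normalizer_le_of_card_eq_sq (hS : IsPGroup p S) {W : Subgroup S}
    (hW : Nat.card W = p ^ 2) (hc : Subgroup.centralizer (W : Set S) ≤ W) :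
    Nat.card (Subgroup.normalizer (W : Set S)) ≤ p ^ 3 := by
  rw [card_normalizer_eq, pow_succ]
  exact Nat.mul_le_mul ((Subgroup.card_le_of_le hc).trans hW.le)
    ((isPGroup_autS hS W).card_le_of_card_eq_sq hW)

theorem Cls.card_normalizer_le (hS : IsPGroup p S) (hess : F.IsEssential p P)
    (hP : Nat.card P = p ^ 3) (hne : ¬ ∀ x y : P, x * y = y * x) (h : F.Cls P A) :
    Nat.card (Subgroup.normalizer (A : Set S)) ≤ p ^ 4 := by
  have hA := h.2.trans hP
  rw [card_normalizer_eq, pow_succ' p 3]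
  refine Nat.mul_le_mul ?_ ((isPGroup_autS hS A).card_le_of_card_eq_cube hA (h.not_comm hne))
  exact card_le_of_central hA (h.not_comm hne) (h.centralizer_le hess) fun w hw x hx =>
    Subgroup.mem_centralizer_iff.1 hw x hx

/-- Once moved into P, W can be moved by Aut_F(P) to an Aut_S(P)-invariant subgroup. Its normalizer
then contains N_S(P), which strictly contains P. -/
theorem exists_mor_card_normalizer_ge (hS : IsPGroup p S) (hess : F.IsEssential p P)
    (hP : Nat.card P = p ^ 3) (hne : ¬ ∀ x y : P, x * y = y * x) {W : Subgroup S}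
    (hW : Nat.card W = p ^ 2) (hWP : F.SubConj W P) :
    ∃ f, F.Mor f W ∧ p ^ 4 ≤ Nat.card (Subgroup.normalizer (img f W : Set S)) := by
  obtain ⟨g, hg, hgP⟩ := hWP
  obtain ⟨H, hH⟩ := hess.2.2.2
  have hinn : innAut P ≤ F.autF P := by
    rintro _ ⟨x, rfl⟩
    exact autS_le_autF P
      (mem_autS_iff.2 ⟨x, Subgroup.le_normalizer x.2, fun y => by simp⟩)
  have hRc : Nat.card ((img g W).subgroupOf P) = p ^ 2 := by
    rw [Nat.card_congr (Subgroup.subgroupOfEquivOfLe hgP).toEquiv, hg.card_img, hW]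
  obtain ⟨b, hb, hbU⟩ := exists_smul_invariant hP hne hinn hH (isPGroup_autS hS P)
    (autS_le_autF P) hRc
  obtain ⟨k, hk⟩ := exists_fun b
  have hkM := (mem_autF_iff hk).1 hb
  refine ⟨k ∘ g, hkM.comp hg hgP, ?_⟩
  have hmem : ∀ x : P, (x : S) ∈ img (k ∘ g) W ↔ x ∈ b • (img g W).subgroupOf P := by
    intro x
    rw [hg.img_comp, (hkM.restrict hgP).mem_img, Subgroup.mem_smul_pointwise_iff_exists]
    constructor
    · rintro ⟨y, hy, hyx⟩
      exact ⟨⟨y, hgP hy⟩, hy, Subtype.ext ((hk _).trans hyx)⟩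
    · rintro ⟨y, hy, rfl⟩
      exact ⟨y, hy, (hk y).symm⟩
  have hle : img (k ∘ g) W ≤ P := by
    rw [hg.img_comp, ← img_eq_of_mulEquiv b hk]
    exact img_mono k hgP
  have hnorm : Subgroup.normalizer (P : Set S) ≤
      Subgroup.normalizer (img (k ∘ g) W : Set S) := by
    intro n hn
    rw [Subgroup.mem_normalizer_iff]
    have hu := hbU (Subgroup.normalizerMonoidHom P ⟨n, hn⟩) ⟨_, rfl⟩
    intro y
    have key : ∀ y : P, (y : S) ∈ img (k ∘ g) W ↔ n * y * n⁻¹ ∈ img (k ∘ g) W := by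
      intro y
      have h1 := hmem (Subgroup.normalizerMonoidHom P ⟨n, hn⟩ y)
      rw [← hu] at h1
      have h2 : Subgroup.normalizerMonoidHom P ⟨n, hn⟩ y ∈
          Subgroup.normalizerMonoidHom P ⟨n, hn⟩ • b • (img g W).subgroupOf P ↔
          y ∈ b • (img g W).subgroupOf P := Subgroup.smul_mem_pointwise_smul_iff
      rw [h2, ← hmem] at h1
      rw [← h1]
      simp
    constructor
    · intro hy
      exact (key ⟨y, hle hy⟩).1 hy
    · intro hy
      have : y ∈ P := (Subgroup.mem_normalizer_iff.1 hn y).2 (hle hy)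
      exact (key ⟨y, this⟩).2 hy
  refine le_trans ?_ (Subgroup.card_le_of_le hnorm)
  refine hS.pow_succ_le_card ?_
  rw [← hP]
  exact Subgroup.card_lt_card_of_lt ((cls_self F P).lt_normalizer hS hess)

theorem cls_of_subConj_of_lt (hS : IsPGroup p S) (hP : Nat.card P = p ^ 3) {W N : Subgroup S}
    (hW : Nat.card W = p ^ 2) (hWN : W < N) (hN : F.SubConj N P) : F.Cls P N := by
  refine ⟨hN, le_antisymm hN.card_le ?_⟩
  rw [hP]
  exact hS.pow_succ_le_card (hW ▸ Subgroup.card_lt_card_of_lt hWN)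

/-- The subgroups of order `p ^ 2` whose normalizer is `F`-conjugate to `P`. -/
def clsNormalizer (F : FusionSystem S) (p : ℕ) (P : Subgroup S) : Set (Subgroup S) :=
  {W | Nat.card W = p ^ 2 ∧ F.Cls P (Subgroup.normalizer (W : Set S))}

theorem centralizer_le_of_mem_clsNormalizer (hS : IsPGroup p S) (hP : Nat.card P = p ^ 3)
    (hne : ¬ ∀ x y : P, x * y = y * x) {W : Subgroup S} (hW : W ∈ F.clsNormalizer p P) :
    Subgroup.centralizer (W : Set S) ≤ W := fun _ hx =>
  mem_of_mem_centralizer hS (hW.2.2.trans hP) (hW.2.not_comm hne) Subgroup.le_normalizer hW.1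
    (Subgroup.centralizer_le_normalizer _ hx) hx

theorem ne_top_of_card_eq_sq (hess : F.IsEssential p P) (hP : Nat.card P = p ^ 3) {W : Subgroup S}
    (hW : Nat.card W = p ^ 2) : W ≠ ⊤ := by
  rintro rfl
  have h1 := card_lt_of_isEssential hess
  rw [Subgroup.card_top] at hW
  rw [hW, hP] at h1
  exact absurd ((Nat.pow_lt_pow_iff_right (Fact.out : p.Prime).one_lt).1 h1) (by norm_num)

variable {C : Set (Subgroup S)}

theorem clsNormalizer_invariant (hS : IsPGroup p S)
    (hC : F.IsEssentialReps p C) (hPC : P ∈ C) (hP : Nat.card P = p ^ 3)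
    (hne : ¬ ∀ x y : P, x * y = y * x) {W : Subgroup S} (hW : W ∈ F.clsNormalizer p P)
    {E : Subgroup S} (hE : E ∈ insert ⊤ (C \ {P})) (hWE : W ≤ E) :
    W ≠ E ∧ Subgroup.normalizer (W : Set S) ≤ E ∧
      ∀ a, F.Mor a E → img a E = E → img a W ∈ F.clsNormalizer p P := by
  have hp : p.Prime := Fact.out
  have hess := hC.1 P hPC
  obtain ⟨hWc, hN⟩ := hW
  have hNc := hN.2.trans hP
  have hWne : W ≠ E := by
    -- An essential subgroup is fully normalized, whereas W has a conjugate with normalizer of order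
    -- at least p⁴ and its own has order p³.
    rintro rfl
    rcases hE with hE | ⟨hEC, -⟩
    · exact ne_top_of_card_eq_sq hess hP hWc hE
    · obtain ⟨f, hf, hfn⟩ := exists_mor_card_normalizer_ge hS hess hP hne hWc
        (hN.1.mono Subgroup.le_normalizer)
      have h1 := (hC.1 W hEC).2.2.1 _ (isConj_iff.2 ⟨f, hf, rfl⟩)
      rw [hNc] at h1
      exact absurd ((Nat.pow_le_pow_iff_right hp.one_lt).1 (hfn.trans h1)) (by norm_num)
  have hNE : Subgroup.normalizer (W : Set S) ≤ E := by
    obtain ⟨x, hxE, hxW, hxn⟩ := hS.exists_mem_normalizer (hWE.lt_of_ne hWne)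
    have hlt : W < Subgroup.normalizer (W : Set S) ⊓ E := SetLike.lt_iff_le_and_exists.2
      ⟨le_inf Subgroup.le_normalizer hWE, x, Subgroup.mem_inf.2 ⟨hxn, hxE⟩, hxW⟩
    have h1 := Subgroup.card_lt_card_of_lt hlt
    rw [hWc] at h1
    rw [← Subgroup.eq_of_le_of_card_ge (inf_le_left : Subgroup.normalizer (W : Set S) ⊓ E ≤ _)
      (by rw [hNc]; exact hS.pow_succ_le_card h1)]
    exact inf_le_right
  refine ⟨hWne, hNE, fun a ha haE => ?_⟩
  set N := Subgroup.normalizer (W : Set S) with hNdef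
  have haN := hN.img (ha.restrict hNE)
  have hNle : img a N ≤ Subgroup.normalizer (img a W : Set S) :=
    (ha.restrict hNE).img_normalizer_le
  refine ⟨by rw [(ha.restrict hWE).card_img, hWc], ?_⟩
  suffices h : Subgroup.normalizer (img a W : Set S) = img a N by rwa [h]
  by_contra hcon
  -- The index of a(N) in its normalizer is at most p, so any B strictly above a(N), which meets
  -- that normalizer in more than a(N), contains all of it.
  have hstep : ∀ B : Subgroup S, img a N < B → Subgroup.normalizer (img a N : Set S) ≤ B := by
    intro B hB
    obtain ⟨x, hxB, hxN, hxn⟩ := hS.exists_mem_normalizer hB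
    have hlt : img a N < Subgroup.normalizer (img a N : Set S) ⊓ B :=
      SetLike.lt_iff_le_and_exists.2
        ⟨le_inf Subgroup.le_normalizer hB.le, x, Subgroup.mem_inf.2 ⟨hxn, hxB⟩, hxN⟩
    have h1 := Subgroup.card_lt_card_of_lt hlt
    rw [haN.2, hP] at h1
    rw [← Subgroup.eq_of_le_of_card_ge
      (inf_le_left : Subgroup.normalizer (img a N : Set S) ⊓ B ≤ _)
      ((haN.card_normalizer_le hS hess hP hne).trans (hS.pow_succ_le_card h1))]
    exact inf_le_right
  have hNE' : img a N < E := by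
    refine lt_of_le_of_ne ((img_mono a hNE).trans haE.le) fun h => ?_
    exact not_cls_of_mem hC hPC hE (h ▸ haN)
  have h1 := hstep E hNE'
  have h2 := hstep _ (hNle.lt_of_ne fun h => hcon h.symm)
  -- If N_S(a(W)) exceeded a(N), then both it and E would contain N_S(a(N)). Applying the inverse of
  -- a sends N_S(a(N)) into N_S(W) = N, so N_S(a(N)) would be no larger than a(N).
  refine (haN.lt_normalizer hS hess).not_ge fun y hy => ?_
  obtain ⟨b, hb, hbx, hbE⟩ := ha.inv
  rw [haE] at hb hbE
  have hyE := h1 hy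
  rw [← haE] at hyE
  obtain ⟨x, hx, rfl⟩ := ha.mem_img.1 hyE
  refine apply_mem_img a ?_
  have haWE : img a W ≤ E := (img_mono a hWE).trans haE.le
  have h3 := hb.normalizer_mem haWE (h1 hy) (h2 hy)
  rw [hbx x hx, ← (ha.restrict hWE).img_comp, img_congr (f := b ∘ a) (g := id)
    (fun w hw => hbx w (hWE hw)), img_id] at h3
  exact h3

theorem exists_isReceptive_of_card_eq_cube_of_card_eq_sq (hS : IsPGroup p S) (hF : F.IsSaturated p)
    (hC : F.IsEssentialReps p C) (hPC : P ∈ C) (hP : Nat.card P = p ^ 3)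
    (hne : ¬ ∀ x y : P, x * y = y * x)
    {G : FusionSystem S} (hG : G = generate (F.automizers (insert ⊤ (C \ {P}))))
    {Q : Subgroup S} (hQ : Nat.card Q = p ^ 2) :
    ∃ R, G.IsConj Q R ∧ G.IsFullyAutomized p R ∧ G.IsReceptive R := by
  have hp : p.Prime := Fact.out
  have hess := hC.1 P hPC
  refine exists_isReceptive_generate hS hF hC P hG (K := {R | Nat.card R = p ^ 2})
    (Y := F.clsNormalizer p P) ?_ ?_ ?_ ?_ hQ
  · intro R hR f hf
    exact hf.card_img.trans hR
  · intro R hR E hE hRE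
    exact (clsNormalizer_invariant hS hC hPC hP hne hR hE hRE).2
  · intro R hR hRY
    have hRN := hS.lt_normalizer (ne_top_of_card_eq_sq hess hP hR)
    refine ⟨id, mor_id _ _, ?_, ?_⟩
    · rw [img_id]
      exact fun h => hRY ⟨hR, cls_of_subConj_of_lt hS hP hR hRN h⟩
    · rw [img_id]
      intro f hf N hN hNP
      by_contra hc
      have hle : R ≤ N := fun x hx => (hN x).2 (hf.ctrl_of_mem hx)
      have hcls := cls_of_subConj_of_lt hS hP hR (hle.lt_of_ne (Ne.symm hc)) hNP
      -- N contains C_S(R), so the self-centralizing property of R inside N holds in S. This bounds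
      -- the normalizer of R by p³, whence it equals N and R is in Y.
      have hcent : Subgroup.centralizer (R : Set S) ≤ R := fun x hx =>
        mem_of_mem_centralizer hS (hcls.2.trans hP) (hcls.not_comm hne) hle hR
          ((hN x).2 (ctrl_of_mem_centralizer hx)) hx
      have h1 := card_normalizer_le_of_card_eq_sq hS hR hcent
      have h2 : N ≤ Subgroup.normalizer (R : Set S) := fun x hx => ((hN x).1 hx).1
      have h3 := Subgroup.eq_of_le_of_card_ge h2 (by rw [hcls.2, hP]; exact h1)
      exact hRY ⟨hR, h3 ▸ hcls⟩
  · intro R hR hRY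
    refine isFullyAutomized_of_card_le hS fun U hU => ?_
    refine (hU.card_le_of_card_eq_sq hR).trans ?_
    have h1 := card_normalizer_eq R
    rw [hRY.2.2, hP] at h1
    have h2 := Subgroup.card_le_of_le (centralizer_le_of_mem_clsNormalizer hS hP hne hRY)
    rw [hRY.1] at h2
    have h3 : p ^ 2 * p ≤ p ^ 2 * Nat.card (autS R) := by
      rw [← pow_succ, h1]
      exact Nat.mul_le_mul_right _ h2
    exact Nat.le_of_mul_le_mul_left h3 (pow_pos hp.pos 2)

theorem exists_isReceptive_of_card_eq_cube (hS : IsPGroup p S) (hF : F.IsSaturated p)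
    (hC : F.IsEssentialReps p C) (hPC : P ∈ C) (hP : Nat.card P = p ^ 3)
    (hne : ¬ ∀ x y : P, x * y = y * x)
    {G : FusionSystem S} (hG : G = generate (F.automizers (insert ⊤ (C \ {P}))))
    (Q : Subgroup S) :
    ∃ R, G.IsConj Q R ∧ G.IsFullyAutomized p R ∧ G.IsReceptive R := by
  have hp : p.Prime := Fact.out
  have hess := hC.1 P hPC
  by_cases hQ : ¬ F.SubConj Q P ∨ F.Cls P Q
  · exact exists_isReceptive_of_not_subConj_or_cls hS hF hC hPC hG hQ
  push Not at hQ
  obtain ⟨n, hn⟩ := IsPGroup.iff_card.1 (hS.to_subgroup Q)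
  have hn3 := hQ.1.card_le.lt_of_ne fun h => hQ.2 ⟨hQ.1, h⟩
  rw [hn, hP, Nat.pow_lt_pow_iff_right hp.one_lt] at hn3
  by_cases hn2 : n = 2
  · subst hn2
    exact exists_isReceptive_of_card_eq_cube_of_card_eq_sq hS hF hC hPC hP hne hG hn
  have hQp : Nat.card Q ∣ p := by
    rw [hn]
    exact (Nat.pow_dvd_pow p (show n ≤ 1 by omega)).trans (pow_one p).dvd
  have hPS := card_lt_of_isEssential hess
  have hZ : Nat.card (Subgroup.center S) = p := by
    have : Nontrivial S := Finite.one_lt_card_iff_nontrivial.1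
      ((Nat.one_le_iff_ne_zero.2 Nat.card_pos.ne').trans_lt hPS)
    have hZ1 := Finite.one_lt_card_iff_nontrivial.2 hS.center_nontrivial
    refine le_antisymm ?_ ?_
    · refine card_le_of_central hP hne
        ((center_le_centralizer P).trans ((cls_self F P).centralizer_le hess)) ?_
      exact fun w hw x _ => Subgroup.mem_center_iff.1 hw x
    · have := hS.pow_succ_le_card (k := 0) (by rwa [pow_zero])
      simpa using this
  refine exists_isReceptive_of_card_dvd_prime hS hF hC hPC hZ hG (Y := F.clsNormalizer p P)
    ?_ ?_ ?_ hQp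
  · exact fun W hW => ⟨hW.1, centralizer_le_of_mem_clsNormalizer hS hP hne hW⟩
  · intro W hW E hE hWE
    obtain ⟨h1, -, h2⟩ := clsNormalizer_invariant hS hC hPC hP hne hW hE hWE
    exact ⟨h1, h2⟩
  · intro R hR hRZ hRY
    by_cases hRN : F.SubConj (Subgroup.normalizer (R : Set S)) P
    swap
    · refine ⟨id, mor_id _ _, ?_⟩
      rwa [img_id]
    have hnc := normalizer_le_centralizer hS hR.dvd
    set W := R ⊔ Subgroup.center S with hW
    have hWN : W ≤ Subgroup.normalizer (R : Set S) := sup_le Subgroup.le_normalizer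
      ((center_le_centralizer R).trans (Subgroup.centralizer_le_normalizer _))
    have hWge : p ^ 2 ≤ Nat.card W := by
      refine hS.pow_succ_le_card (k := 1) ?_
      have hlt : R < R ⊔ Subgroup.center S := left_lt_sup.2 fun h =>
        hRZ (Subgroup.eq_of_le_of_card_ge h (by rw [hR, hZ])).symm
      have := Subgroup.card_lt_card_of_lt hlt
      rwa [hR, ← pow_one p] at this
    have hlt2 : p < p ^ 2 := by
      have := hp.two_le
      nlinarith
    -- N_S(R) centralizes W, of order at least p²; a conjugate of P has a center too small for that.
    have hNc : Nat.card (Subgroup.normalizer (R : Set S)) ≤ p ^ 2 := by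
      by_contra hc
      have h1 := hS.pow_succ_le_card (not_le.1 hc)
      have hcls : F.Cls P (Subgroup.normalizer (R : Set S)) :=
        ⟨hRN, le_antisymm hRN.card_le (by rw [hP]; exact h1)⟩
      have h2 := card_le_of_central (hcls.2.trans hP) (hcls.not_comm hne) hWN fun w hw x hx =>
        (Subgroup.mem_centralizer_iff.1
          (centralizer_le_centralizer_sup_center R (hnc hx)) w hw).symm
      omega
    have hWeq : W = Subgroup.normalizer (R : Set S) :=
      Subgroup.eq_of_le_of_card_ge hWN (hNc.trans hWge)
    have hWc : Nat.card W = p ^ 2 := le_antisymm (hWeq ▸ hNc) hWge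
    have hWP : F.SubConj W P := hRN.mono hWN
    have hWlt := hS.lt_normalizer (ne_top_of_card_eq_sq hess hP hWc)
    have hNW : ¬ F.SubConj (Subgroup.normalizer (W : Set S)) P := fun h =>
      hRY ⟨hWc, cls_of_subConj_of_lt hS hP hWc hWlt h⟩
    -- R itself is badly placed, because N_S(R) = W is conjugate into P. The normalizer of W is not,
    -- so G contains a morphism from it taking W to a fully automized, receptive T, and its
    -- restriction serves as χ.
    obtain ⟨T, hWT, hTa, hTr⟩ := hF W
    obtain ⟨f, hf, hfT⟩ := isConj_iff.1 hWT
    obtain ⟨k, hk, hkT⟩ := exists_mor_normalizer hS hTa hTr hf hfT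
    have hkG : G.Mor k (Subgroup.normalizer (W : Set S)) :=
      hG ▸ generate_mor_of_not_subConj hS hF hC P hNW hk
    refine ⟨k, hkG.restrict (hWeq ▸ Subgroup.le_normalizer), fun hcon => ?_⟩
    have hTc : Nat.card T = p ^ 2 := by rw [← hfT, hf.card_img, hWc]
    -- T is fully normalized, so its normalizer has order at least p⁴, of which Aut_S(T) accounts
    -- for at most a factor p.
    have hTcent : p ^ 3 ≤ Nat.card (Subgroup.centralizer (T : Set S)) := by
      obtain ⟨g, hg, hgn⟩ := exists_mor_card_normalizer_ge hS hess hP hne hTc (hfT ▸ hWP.img hf)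
      have h1 := hgn.trans
        (isFullyNormalized_of_isReceptive hS hTa hTr _ (isConj_iff.2 ⟨g, hg, rfl⟩))
      rw [card_normalizer_eq, pow_succ] at h1
      have h2 := (isPGroup_autS hS T).card_le_of_card_eq_sq hTc
      exact Nat.le_of_mul_le_mul_right (h1.trans (Nat.mul_le_mul_left _ h2)) hp.pos
    have hle : Subgroup.centralizer (T : Set S) ≤ Subgroup.normalizer (img k R : Set S) := by
      refine (centralizer_anti ?_).trans (Subgroup.centralizer_le_normalizer _)
      rw [← hkT]
      exact img_mono k le_sup_left
    -- If N_S(k(R)) were conjugate into P, so would be C_S(T), which by its order would be conjugate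
    -- to P while having the central subgroup T of order p².
    have hcls : F.Cls P (Subgroup.centralizer (T : Set S)) :=
      ⟨hcon.mono hle, le_antisymm (hcon.mono hle).card_le (by rw [hP]; exact hTcent)⟩
    have hcomm := (IsPGroup.isMulCommutative_of_card_eq_prime_sq hTc).is_comm.comm
    have h2 := card_le_of_central (hcls.2.trans hP) (hcls.not_comm hne) (W := T)
      (fun w hw => Subgroup.mem_centralizer_iff.2 fun v hv =>
        congrArg Subtype.val (hcomm ⟨v, hv⟩ ⟨w, hw⟩))
      (fun w hw x hx => (Subgroup.mem_centralizer_iff.1 hx w hw).symm)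
    omega

end FusionSystem

theorem lemma5 {S : Type*} [Group S] [Finite S] (p : ℕ) [Fact p.Prime] (hS : IsPGroup p S)
    (F : FusionSystem S) (hF : F.IsSaturated p)
    (C : Set (Subgroup S)) (hC : F.IsEssentialReps p C)
    (P : Subgroup S) (hPC : P ∈ C) (hP : F.IsPearl p P) :
    (FusionSystem.generate (F.automizers (insert ⊤ (C \ {P})))).IsSaturated p := by
  intro Q
  rcases hP.2 with h | ⟨h, hne⟩
  · exact FusionSystem.exists_isReceptive_of_card_eq_sq hS hF hC hPC h rfl Q
  · exact FusionSystem.exists_isReceptive_of_card_eq_cube hS hF hC hPC h hne rfl Q
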